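/- **Setting.** Let $\mathcal X\subset\mathbb R^m$, $\mathcal Y\subset\mathbb R^n$ be nonempty closed convex sets, $\mathcal Z=\mathcal X\times\mathcal Y$, and consider $$\min_{x\in\mathcal X}\max_{y\in\mathcal Y}\ \ell(x,y):=f(x,y)+h_1(x)-h_2(y),$$ where $h_1,h_2$ are proper closed convex functions with values in $(-\infty,+\infty]$ and $f$ is a real function on an open set containing $\mathcal Z$. Let $\mathbb R^m,\mathbb R^n$ carry arbitrary norms, let $\|(x,y)\|=\sqrt{\|x\|^2+\|y\|^2}$, and let $\|\cdot\|_*$ be the dual norm. Let $\Phi(x,y)=\Phi_{\mathcal X}(x)+\Phi_{\mathcal Y}(y)$, where $\Phi_{\mathcal X},\Phi_{\mathcal Y}$ are differentiable and $1$-strongly convex on $\mathcal X$, $\mathcal Y$ with respect to the given norms, and write $D_\Phi(z',z)=\Phi(z')-\Phi(z)-\langle\nabla\Phi(z),z'-z\rangle$ (similarly $D_{\Phi_{\mathcal X}}, D_{\Phi_{\mathcal Y}}$). Put $F(z)=(\nabla_xf(z),-\nabla_yf(z))$, $H(z)=(\partial h_1(x)+N_{\mathcal X}(x))\times(\partial h_2(y)+N_{\mathcal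 Y}(y))$ with $N$ the normal cone, and $\mathrm{res}(z)=\inf_{w\in H(z)}\|F(z)+w\|_*$ ($=+\infty$ if $H(z)=\emptyset$). Let $p\ge 3$, $\mu>0$, $L_p\ge 0$, $L_\Phi>0$, and assume: * on $\mathcal X\times\mathcal Y$, $f$ is $\mu$-strongly convex in $x$ w.r.t. $\Phi_{\mathcal X}$ and $\mu$-strongly concave in $y$ w.r.t. $\Phi_{\mathcal Y}$, i.e. $f(x',y)\ge f(x,y)+\langle\nabla_xf(x,y),x'-x\rangle+\mu D_{\Phi_{\mathcal X}}(x',x)$ and $-f(x,y')\ge -f(x,y)-\langle\nabla_yf(x,y),y'-y\rangle+\mu D_{\Phi_{\mathcal Y}}(y',y)$ for all $x,x'\in\mathcal X$, $y,y'\in\mathcal Y$; * $f$ is $C^p$ on its domain and $\|D^{p-1}F(z)-D^{p-1}F(z')\|_{\mathrm{op}}\le L_p\|z-z'\|$ for $z,z'\in\mathcal Z$; * $\|\nabla\Phi(z)-\nabla\Phi(z')\|_*\le L_\Phi\|z-z'\|$ for $z,z'\in\mathcal Z$; * $z^*\in\mathcal Z$ is a saddle point of $\ell$ on $\mathcal X\times\mathcal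 Y$, with $h_1,h_2$ finite at its components. **Method.** Let $\lambda\ge L_p$, $\lambda>0$, $\alpha,\beta\in(0,1)$, $\varepsilon>0$, $\sigma_0>0$, $z_0\in\mathcal Z$, and $$T_\lambda(z';z)=\sum_{i=0}^{p-1}\tfrac1{i!}D^iF(z)[z'-z]^i+\tfrac{\lambda}{(p-1)!}\,(2D_\Phi(z',z))^{\frac{p-1}2}(\nabla\Phi(z')-\nabla\Phi(z)).$$ Iteration $k=0,1,2,\dots$: put $v_0=0$ and, for $k\ge1$, $v_k=\frac{\eta_{k-1}}{1+\eta_{k-1}\mu}\,(F(z_k)-T_\lambda(z_k;z_{k-1}))$. For $\eta>0$ let $z(\eta)$ denote the solution $z$, computed by a subsolver, of $$0\in\eta\,T_\lambda(z;z_k)+v_k+\eta H(z)+\nabla\Phi(z)-\nabla\Phi(z_k),$$ and call $\eta$ *admissible* if $\eta\|F(z(\eta))-T_\lambda(z(\eta);z_k)\|_*\le\frac\alpha2\|z(\eta)-z_k\|$. Let $\sigma=\sigma_k$, where $\sigma_{k}=\eta_{k-1}/\beta$ for $k\ge1$. Line search: * If $\sigma$ is inadmissible: start with $\eta_{\rm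 up}=\sigma$, $\eta=\beta\sigma$; while $\eta$ is inadmissible, set $\eta_{\rm up}\leftarrow\eta$ and then $\eta\leftarrow\beta\eta^2/\sigma$. Let $\eta_{\rm lo}$ be the final $\eta$, and go to bisection. * If $\sigma$ is admissible: start with $\eta_{\rm lo}=\sigma$, $\eta=\sigma/\beta$; while $\mathrm{res}(z(\eta_{\rm lo}))>\varepsilon$ and $\eta$ is admissible, set $\eta_{\rm lo}\leftarrow\eta$ and then $\eta\leftarrow\eta^2/(\beta\sigma)$. If now $\mathrm{res}(z(\eta_{\rm lo}))\le\varepsilon$, take $\eta_k=\eta_{\rm lo}$; otherwise let $\eta_{\rm up}$ be the final $\eta$, and go to bisection. * Bisection: while $\eta_{\rm up}/\eta_{\rm lo}>1/\beta$, replace $\eta_{\rm lo}$ (if $\sqrt{\eta_{\rm lo}\eta_{\rm up}}$ is admissible) or $\eta_{\rm up}$ (if it is not) by $\sqrt{\eta_{\rm lo}\eta_{\rm up}}$. Take $\eta_k=\eta_{\rm lo}$. Then $z_{k+1}=z(\eta_k)$. If $\mathrm{res}(z_{k+1})\le\varepsilon$, the method stops and returns $z_{k+1}$. **Constants.** $L_p(\Phi,\lambda)=L_p+pL_\Phi^{\frac{p+1}2}\lambda$,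 $$\gamma_p=\sqrt{\tfrac2{1-\alpha}}\,L_\Phi^{3/2}\Big(\tfrac2{p!\,\alpha\beta^p}\Big)^{\frac1{p-1}}+\tfrac1{\sqrt{2(1-\alpha)}}\Big(\tfrac2{p!\,\alpha\beta^p}\Big)^{\frac1{p-1}}\alpha\,(\beta+L_\Phi^{1/2}),\qquad \tilde\kappa_p(z_0)=\frac{\gamma_p^{p-1}L_p(\Phi,\lambda)\,D_\Phi(z^*,z_0)^{\frac{p-1}2}}{\mu}.$$ **Claim.** Let $(z_k),(\eta_k)$ be generated by the method. Say that the method finds an $\varepsilon$-accurate solution within $B$ iterations if for some integer $N$ with $0\le N\le B$ it reaches $z_N$, and either it returns $z_N$ (so $N\ge1$ and $\mathrm{res}(z_N)\le\varepsilon$) or $D_\Phi(z^*,z_N)\le\varepsilon$. 1. If $\varepsilon\ge\frac1{(2-\alpha)\gamma_p^2}\big(\frac{\mu}{L_p(\Phi,\lambda)}\big)^{\frac2{p-1}}$, the method finds an $\varepsilon$-accurate solution within $$\max\Big\{\frac{[\tilde\kappa_p(z_0)]^{\frac2{p+1}}}{1-2^{-\frac{p-1}{p+1}}}+\log_2\Big(\frac{2D_\Phi(z^*,z_0)}{(2-\alpha)\varepsilon}\Big)+1,\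 1\Big\}\ \text{iterations.}$$ 2. If $\varepsilon<\frac1{(2-\alpha)\gamma_p^2}\big(\frac{\mu}{L_p(\Phi,\lambda)}\big)^{\frac2{p-1}}$, the method finds an $\varepsilon$-accurate solution within $$\max\Big\{\frac{[\tilde\kappa_p(z_0)]^{\frac2{p+1}}}{1-2^{-\frac{p-1}{p+1}}}+\frac{2\log_2\tilde\kappa_p(z_0)}{p-1}+2,\ 1\Big\}+\log_{\frac{p+1}2}\log_2\Big(\frac{2\mu^{\frac2{p-1}}}{(2-\alpha)\gamma_p^2L_p(\Phi,\lambda)^{\frac2{p-1}}\varepsilon}\Big)+1\ \text{iterations.}$$ (If $z_0=z^*$, then $N=0$ works in both cases, and the logarithms of $0$ are read as any convention that keeps the bounds nonnegative, e.g. $\log_2 0=0$.) -/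

import Mathlib

noncomputable section

namespace SaddleOpt

open Set

/-! ## Convex analysis -/

section ConvexAnalysis

variable {V : Type*} [NormedAddCommGroup V] [NormedSpace ℝ V]

/-- A proper closed convex function `h : V → (-∞, +∞]`. -/
structure ProperClosedConvex (h : V → EReal) : Prop where
  ne_bot : ∀ x, h x ≠ ⊥
  exists_ne_top : ∃ x, h x ≠ ⊤
  lsc : LowerSemicontinuous h
  convex_epigraph : Convex ℝ {q : V × ℝ | h q.1 ≤ (q.2 : EReal)}

/-- The subdifferential of `h` at `x`. Vectors that are only ever paired with points
(gradients, subgradients, values of the operators) live in the dual space, whose operator norm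
is the dual norm. -/
def subdifferential (h : V → EReal) (x : V) : Set (V →L[ℝ] ℝ) :=
  {g | ∀ x', h x + ((g (x' - x) : ℝ) : EReal) ≤ h x'}

/-- The normal cone of `C` at `x`; it is empty when `x ∉ C`. -/
def normalCone (C : Set V) (x : V) : Set (V →L[ℝ] ℝ) :=
  {v | x ∈ C ∧ ∀ x' ∈ C, v (x' - x) ≤ 0}

/-- The Bregman distance `D_Φ(x', x) = Φ(x') - Φ(x) - ⟨∇Φ(x), x' - x⟩`. -/
def bregman (Φ : V → ℝ) (x' x : V) : ℝ :=
  Φ x' - Φ x - fderiv ℝ Φ x (x' - x)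

/-- `Φ` is differentiable at the points of `C` and `1`-strongly convex on `C` with respect to
the norm of `V`. -/
structure IsMirrorMap (Φ : V → ℝ) (C : Set V) : Prop where
  differentiable : ∀ x ∈ C, DifferentiableAt ℝ Φ x
  strong : ∀ x ∈ C, ∀ x' ∈ C, 1 / 2 * ‖x' - x‖ ^ 2 ≤ bregman Φ x' x

/-- The Taylor polynomial of order `n` of an operator `G` at `z`, evaluated at `z'`:
`∑_{i ≤ n} D^i G(z)[z' - z]^i / i!`. -/
def taylorPoly {W : Type*} [NormedAddCommGroup W] [NormedSpace ℝ W]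
    (G : V → W) (n : ℕ) (z' z : V) : W :=
  ∑ i ∈ Finset.range (n + 1),
    (1 / (i.factorial : ℝ)) • iteratedFDeriv ℝ i G z (fun _ => z' - z)

end ConvexAnalysis

/-! ## Composite saddle point problems -/

/-- The product space, with the norm `‖(x, y)‖ = √(‖x‖² + ‖y‖²)`. -/
abbrev Sp (E F : Type*) := WithLp 2 (E × F)

/-- The problem `min_{x ∈ X} max_{y ∈ Y} f(x,y) + h₁(x) - h₂(y)` together with mirror maps on `X`
and `Y`. The arbitrary norms on the two finite-dimensional spaces are the norms of `E` and `F`. -/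
structure SaddleProblem (E F : Type*) [NormedAddCommGroup E] [NormedSpace ℝ E]
    [NormedAddCommGroup F] [NormedSpace ℝ F] where
  X : Set E
  Y : Set F
  X_nonempty : X.Nonempty
  Y_nonempty : Y.Nonempty
  X_closed : IsClosed X
  Y_closed : IsClosed Y
  X_convex : Convex ℝ X
  Y_convex : Convex ℝ Y
  /-- the open domain of the smooth part -/
  domf : Set (Sp E F)
  domf_open : IsOpen domf
  f : Sp E F → ℝ
  subset_domf : ∀ z : Sp E F, z.fst ∈ X → z.snd ∈ Y → z ∈ domf
  h₁ : E → EReal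
  h₂ : F → EReal
  h₁_pcc : ProperClosedConvex h₁
  h₂_pcc : ProperClosedConvex h₂
  ΦX : E → ℝ
  ΦY : F → ℝ
  ΦX_mirror : IsMirrorMap ΦX X
  ΦY_mirror : IsMirrorMap ΦY Y

namespace SaddleProblem

variable {E F : Type*} [NormedAddCommGroup E] [NormedSpace ℝ E]
  [NormedAddCommGroup F] [NormedSpace ℝ F] (Q : SaddleProblem E F)

/-- The feasible set `Z = X × Y`. -/
def Z : Set (Sp E F) := {z | z.fst ∈ Q.X ∧ z.snd ∈ Q.Y}

/-- The objective `ℓ(x,y) = f(x,y) + h₁(x) - h₂(y)`. -/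
def objective (x : E) (y : F) : EReal :=
  (Q.f (WithLp.toLp 2 (x, y)) : EReal) + Q.h₁ x - Q.h₂ y

/-- A saddle point of the problem (with finite value). -/
structure IsSaddlePoint (zs : Sp E F) : Prop where
  mem : zs ∈ Q.Z
  h₁_ne_top : Q.h₁ zs.fst ≠ ⊤
  h₂_ne_top : Q.h₂ zs.snd ≠ ⊤
  le_left : ∀ y ∈ Q.Y, Q.objective zs.fst y ≤ Q.objective zs.fst zs.snd
  le_right : ∀ x ∈ Q.X, Q.objective zs.fst zs.snd ≤ Q.objective x zs.snd

/-- The partial gradient `∇ₓ f`. -/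
def gradX (z : Sp E F) : E →L[ℝ] ℝ :=
  ((fderiv ℝ Q.f z).comp (WithLp.prodContinuousLinearEquiv 2 ℝ E F).symm.toContinuousLinearMap).comp
    (ContinuousLinearMap.inl ℝ E F)

/-- The partial gradient `∇_y f`. -/
def gradY (z : Sp E F) : F →L[ℝ] ℝ :=
  ((fderiv ℝ Q.f z).comp (WithLp.prodContinuousLinearEquiv 2 ℝ E F).symm.toContinuousLinearMap).comp
    (ContinuousLinearMap.inr ℝ E F)

/-- The functional `(a, b)` on the product space, `(x, y) ↦ a x + b y`. -/
def pair (a : E →L[ℝ] ℝ) (b : F →L[ℝ] ℝ) : Sp E F →L[ℝ] ℝ :=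
  a.comp (WithLp.fstL 2 ℝ E F) + b.comp (WithLp.sndL 2 ℝ E F)

/-- The operator `F = (∇ₓ f, -∇_y f)`. -/
def op (z : Sp E F) : Sp E F →L[ℝ] ℝ := pair (Q.gradX z) (-Q.gradY z)

/-- The set-valued operator `H = (∂h₁, ∂h₂) + (N_X, N_Y)`. -/
def H (z : Sp E F) : Set (Sp E F →L[ℝ] ℝ) :=
  {w | ∃ a ∈ subdifferential Q.h₁ z.fst, ∃ a' ∈ normalCone Q.X z.fst,
    ∃ b ∈ subdifferential Q.h₂ z.snd, ∃ b' ∈ normalCone Q.Y z.snd,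
      w = pair (a + a') (b + b')}

/-- The mirror map `Φ(x,y) = Φ_X(x) + Φ_Y(y)` of the product. -/
def Φ (z : Sp E F) : ℝ := Q.ΦX z.fst + Q.ΦY z.snd

/-- `∇Φ`. -/
def gradΦ (z : Sp E F) : Sp E F →L[ℝ] ℝ := fderiv ℝ Q.Φ z

/-- `D_Φ` on the product. -/
def D (z' z : Sp E F) : ℝ := bregman Q.Φ z' z

/-- The residual `inf_{w ∈ H(z)} ‖F(z) + w‖_*`, equal to `+∞` if `H(z)` is empty. -/
def res (z : Sp E F) : ENNReal := ⨅ w ∈ Q.H z, ENNReal.ofReal ‖Q.op z + w‖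

/-- `f` is `μ`-strongly convex in `x` w.r.t. `Φ_X` and `μ`-strongly concave in `y` w.r.t. `Φ_Y`
on `X × Y`. -/
structure StronglyConvexConcave (μ : ℝ) : Prop where
  convex : ∀ z ∈ Q.Z, ∀ x' ∈ Q.X,
    Q.f z + Q.gradX z (x' - z.fst) + μ * bregman Q.ΦX x' z.fst
      ≤ Q.f (WithLp.toLp 2 (x', z.snd))
  concave : ∀ z ∈ Q.Z, ∀ y' ∈ Q.Y,
    -Q.f z - Q.gradY z (y' - z.snd) + μ * bregman Q.ΦY y' z.snd
      ≤ -Q.f (WithLp.toLp 2 (z.fst, y'))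

/-- The operator `F` is `p`-th-order `L`-smooth on `Z`: `f` is `C^p` on its open domain, and the
derivative of order `p - 1` of `F` is `L`-Lipschitz on `Z` in operator norm. -/
structure OpSmooth (p : ℕ) (L : ℝ) : Prop where
  contDiffOn : ContDiffOn ℝ p Q.f Q.domf
  lipschitz : ∀ z ∈ Q.Z, ∀ z' ∈ Q.Z,
    ‖iteratedFDeriv ℝ (p - 1) Q.op z - iteratedFDeriv ℝ (p - 1) Q.op z'‖ ≤ L * ‖z - z'‖

/-- `Φ` is `L`-smooth on `Z`. -/
def MirrorSmooth (L : ℝ) : Prop :=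
  ∀ z ∈ Q.Z, ∀ z' ∈ Q.Z, ‖Q.gradΦ z - Q.gradΦ z'‖ ≤ L * ‖z - z'‖

/-- The regularized Taylor expansion
`T_λ^{(p-1)}(z'; z) = T^{(p-1)}(z'; z) + λ/(p-1)! (2 D_Φ(z',z))^{(p-1)/2} (∇Φ(z') - ∇Φ(z))`. -/
def regTaylor (p : ℕ) (lam : ℝ) (z' z : Sp E F) : Sp E F →L[ℝ] ℝ :=
  taylorPoly Q.op (p - 1) z' z +
    (lam / ((p - 1).factorial : ℝ) * (2 * Q.D z' z) ^ (((p : ℝ) - 1) / 2)) •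
      (Q.gradΦ z' - Q.gradΦ z)

end SaddleProblem

/-! ## The line search

The subroutines are described through the outcomes of the tests that they make at trial
stepsizes: `adm η` and `inadm η` say that the subsolver has been called with stepsize `η` and that
its answer passes, or fails, the stepsize test; `small η` and `large η` say that the residual of
its answer is at most `ε`, or larger than `ε`. Each inductive predicate relates the state of a
subroutine to the values that it returns, so it holds only for terminating executions. -/

section LineSearch

variable (adm inadm small large : ℝ → Prop) (β σ : ℝ)

/-- The while loop of the backtracking subroutine: from the state `(η_up, η)` it returns
`(η_lo, η_up)`. -/
inductive BacktrackLoop : ℝ → ℝ → ℝ → ℝ → Prop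
  | exit (up η : ℝ) : adm η → BacktrackLoop up η η up
  | step (up η lo' up' : ℝ) : inadm η → BacktrackLoop η (β * η ^ 2 / σ) lo' up' →
      BacktrackLoop up η lo' up'

/-- The while loop of the advancing subroutine: from the state `(η_lo, η)` it returns
`(η_lo, η_up)`. -/
inductive AdvanceLoop : ℝ → ℝ → ℝ → ℝ → Prop
  | exit (lo η : ℝ) : small lo ∨ inadm η → AdvanceLoop lo η lo η
  | step (lo η lo' up' : ℝ) : large lo → adm η → AdvanceLoop η (η ^ 2 / (β * σ)) lo' up' →
      AdvanceLoop lo η lo' up'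

/-- The bisection subroutine: from the state `(η_lo, η_up)` it returns a stepsize. -/
inductive BisectionLoop : ℝ → ℝ → ℝ → Prop
  | exit (lo up : ℝ) : up / lo ≤ 1 / β → BisectionLoop lo up lo
  | raise (lo up r : ℝ) : 1 / β < up / lo → adm (Real.sqrt (lo * up)) →
      BisectionLoop (Real.sqrt (lo * up)) up r → BisectionLoop lo up r
  | lower (lo up r : ℝ) : 1 / β < up / lo → inadm (Real.sqrt (lo * up)) →
      BisectionLoop lo (Real.sqrt (lo * up)) r → BisectionLoop lo up r

/-- The line search with advancing, started at the trial stepsize `σ`, returns a stepsize. -/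
inductive LineSearch : ℝ → Prop
  | backtrack (lo up η : ℝ) : inadm σ → BacktrackLoop adm inadm β σ σ (β * σ) lo up →
      BisectionLoop adm inadm β lo up η → LineSearch η
  | accept (lo up : ℝ) : adm σ → AdvanceLoop adm inadm small large β σ σ (σ / β) lo up →
      small lo → LineSearch lo
  | advance (lo up η : ℝ) : adm σ → AdvanceLoop adm inadm small large β σ σ (σ / β) lo up →
      large lo → BisectionLoop adm inadm β lo up η → LineSearch η

end LineSearch

/-! ## The `p`-th-order optimistic method -/

/-- The inputs of the method other than the initial point: the order `p`, the strong convexity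
parameter `μ`, the regularization parameter `λ`, the line search parameters `α, β`, the accuracy
`ε`, and the initial trial stepsize `σ₀`. -/
structure Params where
  p : ℕ
  μ : ℝ
  lam : ℝ
  α : ℝ
  β : ℝ
  ε : ℝ
  σ₀ : ℝ

namespace SaddleProblem

variable {E F : Type*} [NormedAddCommGroup E] [NormedSpace ℝ E]
  [NormedAddCommGroup F] [NormedSpace ℝ F] (Q : SaddleProblem E F) (A : Params)

/-- `z` solves the subproblem at `z⁻` with stepsize `η` and correction term `v`:
`0 ∈ η T_λ^{(p-1)}(z; z⁻) + v + η H(z) + ∇Φ(z) - ∇Φ(z⁻)`. -/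
def IsSubsolution (zm : Sp E F) (v : Sp E F →L[ℝ] ℝ) (η : ℝ) (z : Sp E F) : Prop :=
  ∃ w ∈ Q.H z,
    η • Q.regTaylor A.p A.lam z zm + v + η • w + Q.gradΦ z - Q.gradΦ zm = 0

/-- The stepsize test `η ‖F(z) - T_λ^{(p-1)}(z; z⁻)‖_* ≤ (α/2) ‖z - z⁻‖`. -/
def StepTest (zm : Sp E F) (η : ℝ) (z : Sp E F) : Prop :=
  η * ‖Q.op z - Q.regTaylor A.p A.lam z zm‖ ≤ A.α / 2 * ‖z - zm‖

/-- The line search at `z⁻` with correction term `v` and trial stepsize `σ` returns `η`. -/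
def LineSearchReturns (zm : Sp E F) (v : Sp E F →L[ℝ] ℝ) (σ η : ℝ) : Prop :=
  LineSearch
    (fun t => ∃ z, Q.IsSubsolution A zm v t z ∧ Q.StepTest A zm t z)
    (fun t => ∃ z, Q.IsSubsolution A zm v t z ∧ ¬ Q.StepTest A zm t z)
    (fun t => ∃ z, Q.IsSubsolution A zm v t z ∧ Q.res z ≤ ENNReal.ofReal A.ε)
    (fun t => ∃ z, Q.IsSubsolution A zm v t z ∧ ENNReal.ofReal A.ε < Q.res z)
    A.β σ η

/-- The correction term `v_k = η̂_k (F(z_k) - T_λ^{(p-1)}(z_k; z_{k-1}))` with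
`η̂_k = η_{k-1} / (1 + η_{k-1} μ)`; it vanishes for `k = 0`, because the prediction at `z₀` is
initialized as `F(z₀)`. -/
def correction (z : ℕ → Sp E F) (η : ℕ → ℝ) : ℕ → (Sp E F →L[ℝ] ℝ)
  | 0 => 0
  | k + 1 => (η k / (1 + η k * A.μ)) •
      (Q.op (z (k + 1)) - Q.regTaylor A.p A.lam (z (k + 1)) (z k))

/-- The initial trial stepsize of iteration `k`: `σ₀`, and `σ_{k+1} = η_k / β`. -/
def trial (A : Params) (η : ℕ → ℝ) : ℕ → ℝ
  | 0 => A.σ₀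
  | k + 1 => η k / A.β

/-- The method returns `z_k`: the point has been computed by an iteration (so `k ≥ 1`) and its
residual is at most `ε`. -/
def Returns (z : ℕ → Sp E F) (k : ℕ) : Prop :=
  1 ≤ k ∧ Q.res (z k) ≤ ENNReal.ofReal A.ε

/-- `z₀, z₁, …` and `η₀, η₁, …` are generated by the `p`-th-order optimistic method: iteration `k`
is executed as long as none of `z₁, …, z_k` has been returned. -/
structure IsRun (z : ℕ → Sp E F) (η : ℕ → ℝ) : Prop where
  init : z 0 ∈ Q.Z
  stepsize : ∀ k, (∀ j ≤ k, ¬ Q.Returns A z j) →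
    Q.LineSearchReturns A (z k) (Q.correction A z η k) (trial A η k) (η k)
  update : ∀ k, (∀ j ≤ k, ¬ Q.Returns A z j) →
    Q.IsSubsolution A (z k) (Q.correction A z η k) (η k) (z (k + 1))

/-- Within at most `B` iterations the method finds an `ε`-accurate solution: it reaches an iterate
`z_N` with `N ≤ B` that it returns, or that satisfies `D_Φ(z*, z_N) ≤ ε`. -/
def FindsWithin (zs : Sp E F) (z : ℕ → Sp E F) (B : ℝ) : Prop :=
  ∃ N : ℕ, (N : ℝ) ≤ B ∧ (∀ j < N, ¬ Q.Returns A z j) ∧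
    (Q.Returns A z N ∨ Q.D zs (z N) ≤ A.ε)

end SaddleProblem

/-! ## The constants -/

/-- `L_p(Φ, λ) = L_p + p L_Φ^{(p+1)/2} λ`. -/
def effLip (p : ℕ) (Lp LΦ lam : ℝ) : ℝ :=
  Lp + p * LΦ ^ (((p : ℝ) + 1) / 2) * lam

/-- The constant `γ_p`. -/
def gammaConst (p : ℕ) (LΦ α β : ℝ) : ℝ :=
  Real.sqrt (2 / (1 - α)) * LΦ ^ ((3 : ℝ) / 2) *
      (2 / ((p.factorial : ℝ) * α * β ^ p)) ^ (1 / ((p : ℝ) - 1)) +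
    1 / Real.sqrt (2 * (1 - α)) *
      (2 / ((p.factorial : ℝ) * α * β ^ p)) ^ (1 / ((p : ℝ) - 1)) *
      α * (β + LΦ ^ ((1 : ℝ) / 2))

/-- `κ̃_p(z₀) = γ_p^{p-1} L_p(Φ,λ) D_Φ(z*,z₀)^{(p-1)/2} / μ`, with `D₀ = D_Φ(z*,z₀)`. -/
def kappaTilde (p : ℕ) (μ Lp LΦ lam α β D₀ : ℝ) : ℝ :=
  gammaConst p LΦ α β ^ (p - 1) * effLip p Lp LΦ lam * D₀ ^ (((p : ℝ) - 1) / 2) / μ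

end SaddleOpt

end

/-!
Write `v_k` for the correction term of iteration `k`, and `δ_k = ‖z_{k+1} - z_k‖`.

**Subproblems.** The Taylor remainder of `F` at `z` is locally Lipschitz with constant
`L_p / (p-1)! · ‖· - z‖ ^ (p-1)`, and the regularizer is monotone with a modulus that dominates this
constant because `λ ≥ L_p` and `2 D_Φ(z', z) ≥ ‖z' - z‖²`. Both are two-point estimates that match
only at coinciding points, so `T_λ(·; z)` is monotone up to a cubic error
(`regTaylor_almost_monotone`); subdividing segments removes the error (`regTaylor_monotone`). Hence
the subproblems have at most one solution, and all tests of the line search at a given stepsize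
concern the same point.

**Stepsizes.** Unless the new residual is small, the line search ends with an inadmissible stepsize
`t ∈ [η_k, η_k / β]` (`LineSearch.spec`). Failure of the test at `t` bounds `t` from below in terms
of `‖z(t) - z_k‖`, and by monotonicity `‖z(t) - z_k‖` is bounded by `δ_k` and the norm of the
correction term `v_k` (`IsSubsolution.norm_sub_le`). So `1 / η_k` is at most a multiple of
`(a δ_k + b ‖v_k‖) ^ (p-1)` (`LineSearchReturns.spec`).

**Energy.** The potential `D_Φ(z*, z_k) - ⟨v_k, z_k - z*⟩` contracts by `1 + η_k μ` in each step, up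
to terms that telescope. With `c_k = ∏_{j<k} (1 + η_j μ)` this gives
`c_N (1 - α/2) D_Φ(z*, z_N) + (1 - α)/2 · ∑_{k<N} c_k δ_k² ≤ D_Φ(z*, z_0)` (`energy_le`). Together
with the stepsize bound and Minkowski's inequality, `∑_{k<N} c_k (η_k μ) ^ (-r) ≤ K`, where
`r = 2 / (p-1)` and `K = κ̃_p(z_0) ^ r` (`IsRun.growth_bounds`).

**Counting.** The rest concerns the real sequence `x_k = η_k μ`. Steps with `x_k ≥ 1` double `c_k`;
the number of the others is at most `2 K ^ (1/(1+r))` by the weighted inequality of arithmetic and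
geometric means (`count_le_add_logb_growth`). Once `c_k ≥ 2 K`, the bound on the single term
`c_k x_k ^ (-r)` gives `c_{k+1} / K ≥ (c_k / K) ^ (1 + 1/r)`, which is superlinear convergence of
order `1 + 1/r = (p+1)/2` (`superlinear_growth`, `count_le_superlinear`).
-/

namespace SaddleOpt

open Set

namespace SaddleProblem

variable {E F : Type*} [NormedAddCommGroup E] [NormedSpace ℝ E]
  [NormedAddCommGroup F] [NormedSpace ℝ F] (Q : SaddleProblem E F)

/-! ### Geometry of the mirror map -/

@[simp]
lemma pair_apply (a : E →L[ℝ] ℝ) (b : F →L[ℝ] ℝ) (z : Sp E F) :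
    pair a b z = a z.fst + b z.snd := rfl

lemma hasFDerivAt_Φ {z : Sp E F} (hz : z ∈ Q.Z) :
    HasFDerivAt Q.Φ (pair (fderiv ℝ Q.ΦX z.fst) (fderiv ℝ Q.ΦY z.snd)) z := by
  have h1 : HasFDerivAt (Q.ΦX ∘ WithLp.fstL 2 ℝ E F)
      ((fderiv ℝ Q.ΦX z.fst).comp (WithLp.fstL 2 ℝ E F)) z :=
    HasFDerivAt.comp z (Q.ΦX_mirror.differentiable _ hz.1).hasFDerivAt
      (WithLp.fstL 2 ℝ E F).hasFDerivAt
  have h2 : HasFDerivAt (Q.ΦY ∘ WithLp.sndL 2 ℝ E F)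
      ((fderiv ℝ Q.ΦY z.snd).comp (WithLp.sndL 2 ℝ E F)) z :=
    HasFDerivAt.comp z (Q.ΦY_mirror.differentiable _ hz.2).hasFDerivAt
      (WithLp.sndL 2 ℝ E F).hasFDerivAt
  exact h1.add h2

lemma D_eq_add {z : Sp E F} (hz : z ∈ Q.Z) (z' : Sp E F) :
    Q.D z' z = bregman Q.ΦX z'.fst z.fst + bregman Q.ΦY z'.snd z.snd := by
  simp only [D, bregman, (Q.hasFDerivAt_Φ hz).fderiv, pair_apply, Φ, WithLp.sub_fst,
    WithLp.sub_snd]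
  ring

lemma half_sq_le_D {z z' : Sp E F} (hz : z ∈ Q.Z) (hz' : z' ∈ Q.Z) :
    1 / 2 * ‖z' - z‖ ^ 2 ≤ Q.D z' z := by
  rw [Q.D_eq_add hz, WithLp.prod_norm_sq_eq_of_L2]
  have h1 := Q.ΦX_mirror.strong _ hz.1 _ hz'.1
  have h2 := Q.ΦY_mirror.strong _ hz.2 _ hz'.2
  simp only [WithLp.sub_fst, WithLp.sub_snd]
  linarith

lemma D_nonneg {z z' : Sp E F} (hz : z ∈ Q.Z) (hz' : z' ∈ Q.Z) : 0 ≤ Q.D z' z :=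
  le_trans (by positivity) (Q.half_sq_le_D hz hz')

lemma D_eq (z' z : Sp E F) : Q.D z' z = Q.Φ z' - Q.Φ z - Q.gradΦ z (z' - z) := rfl

/-- The three-point identity of Bregman distances. -/
lemma gradΦ_sub_apply (a b c : Sp E F) :
    (Q.gradΦ a - Q.gradΦ b) (b - c) = Q.D c a - Q.D c b - Q.D b a := by
  simp only [D_eq, sub_apply, map_sub]
  ring

lemma sq_le_gradΦ_sub {a b : Sp E F} (ha : a ∈ Q.Z) (hb : b ∈ Q.Z) :
    ‖a - b‖ ^ 2 ≤ (Q.gradΦ a - Q.gradΦ b) (a - b) := by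
  have h1 := Q.half_sq_le_D ha hb
  have h2 := Q.half_sq_le_D hb ha
  rw [norm_sub_rev] at h1
  simp only [D_eq, sub_apply, map_sub] at *
  linarith

lemma Z_convex : Convex ℝ Q.Z := by
  intro a ha b hb s t hs ht hst
  exact ⟨Q.X_convex ha.1 hb.1 hs ht hst, Q.Y_convex ha.2 hb.2 hs ht hst⟩

lemma add_smul_sub_mem {a b : Sp E F} (ha : a ∈ Q.Z) (hb : b ∈ Q.Z) {t : ℝ}
    (ht : t ∈ Icc (0 : ℝ) 1) : a + t • (b - a) ∈ Q.Z :=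
  Q.Z_convex.add_smul_sub_mem ha hb ht

lemma D_le {LΦ : ℝ} (hΦ : Q.MirrorSmooth LΦ) {z z' : Sp E F} (hz : z ∈ Q.Z) (hz' : z' ∈ Q.Z) :
    2 * Q.D z' z ≤ LΦ * ‖z' - z‖ ^ 2 := by
  set u := z' - z with hu
  have hd : ∀ t ∈ Icc (0 : ℝ) 1, HasDerivAt
      (fun t : ℝ => Q.Φ (z + t • u) - t * Q.gradΦ z u - LΦ / 2 * ‖u‖ ^ 2 * t ^ 2)
      (Q.gradΦ (z + t • u) u - Q.gradΦ z u - LΦ * ‖u‖ ^ 2 * t) t := by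
    intro t ht
    have hm := Q.add_smul_sub_mem hz hz' ht
    have h1 : HasFDerivAt Q.Φ (Q.gradΦ (z + t • u)) (z + t • u) :=
      (Q.hasFDerivAt_Φ hm).differentiableAt.hasFDerivAt
    have h2 : HasDerivAt (fun t : ℝ => z + t • u) u t := by
      simpa using ((hasDerivAt_id t).smul_const u).const_add z
    have h3 := h1.comp_hasDerivAt t h2
    refine ((h3.sub ((hasDerivAt_id t).mul_const (Q.gradΦ z u))).sub
      (((hasDerivAt_id t).pow 2).const_mul (LΦ / 2 * ‖u‖ ^ 2))).congr_deriv ?_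
    simp
    ring
  have hanti : AntitoneOn
      (fun t : ℝ => Q.Φ (z + t • u) - t * Q.gradΦ z u - LΦ / 2 * ‖u‖ ^ 2 * t ^ 2) (Icc 0 1) := by
    refine antitoneOn_of_deriv_nonpos (convex_Icc 0 1)
      (fun t ht => (hd t ht).continuousAt.continuousWithinAt)
      (fun t ht => ((hd t (interior_subset ht)).differentiableAt).differentiableWithinAt)
      fun t ht => ?_
    have ht' : t ∈ Icc (0 : ℝ) 1 := interior_subset ht
    rw [(hd t ht').deriv]
    have h1 := hΦ _ (Q.add_smul_sub_mem hz hz' ht') _ hz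
    have h2 := (Q.gradΦ (z + t • u) - Q.gradΦ z).le_opNorm u
    rw [add_sub_cancel_left, norm_smul, Real.norm_of_nonneg ht'.1] at h1
    have h3 := le_trans (le_abs_self _) h2
    have h4 : ‖Q.gradΦ (z + t • u) - Q.gradΦ z‖ * ‖u‖ ≤ LΦ * (t * ‖u‖) * ‖u‖ := by
      gcongr
    simp only [sub_apply] at h3
    nlinarith
  have h := hanti (left_mem_Icc.2 zero_le_one) (right_mem_Icc.2 zero_le_one) zero_le_one
  simp only [one_smul, zero_smul, add_zero, hu, add_sub_cancel] at h
  rw [D_eq]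
  linarith

/-- A set with two points forces the smoothness constant of a `1`-strongly convex mirror map
to be at least `1`. -/
lemma one_le_of_ne {LΦ : ℝ} (hΦ : Q.MirrorSmooth LΦ) {z z' : Sp E F} (hz : z ∈ Q.Z)
    (hz' : z' ∈ Q.Z) (hne : z' ≠ z) : 1 ≤ LΦ := by
  have h1 := Q.D_le hΦ hz hz'
  have h2 := Q.half_sq_le_D hz hz'
  have h3 : 0 < ‖z' - z‖ ^ 2 := by
    have := norm_pos_iff.2 (sub_ne_zero.2 hne)
    positivity
  by_contra hlt
  nlinarith

/-! ### Monotonicity of the operators -/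

lemma mem_Z_of_mem_H {z : Sp E F} {w : Sp E F →L[ℝ] ℝ} (hw : w ∈ Q.H z) : z ∈ Q.Z := by
  obtain ⟨a, -, a', ha', b, -, b', hb', -⟩ := hw
  exact ⟨ha'.1, hb'.1⟩

end SaddleProblem

/-- At a point where the subdifferential is nonempty, a proper function is finite, so the
subgradient inequality at points of finite value is one between real numbers. -/
lemma subgradient_real {V : Type*} [NormedAddCommGroup V] [NormedSpace ℝ V] {h : V → EReal}
    (hh : ProperClosedConvex h) {x : V} {g : V →L[ℝ] ℝ} (hg : g ∈ subdifferential h x) :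
    h x ≠ ⊤ ∧ ∀ x', h x' ≠ ⊤ → (h x).toReal + g (x' - x) ≤ (h x').toReal := by
  have hx : h x ≠ ⊤ := by
    intro htop
    obtain ⟨x', hx'⟩ := hh.exists_ne_top
    have := hg x'
    rw [htop, EReal.top_add_coe] at this
    exact hx' (top_le_iff.1 this)
  refine ⟨hx, fun x' hx' => ?_⟩
  have := hg x'
  rw [← EReal.coe_toReal hx (hh.ne_bot x), ← EReal.coe_toReal hx' (hh.ne_bot x')] at this
  exact_mod_cast this

namespace SaddleProblem

variable {E F : Type*} [NormedAddCommGroup E] [NormedSpace ℝ E]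
  [NormedAddCommGroup F] [NormedSpace ℝ F] (Q : SaddleProblem E F)

/-- The subgradient inequality for an element of `H`: for `w ∈ H(x, y)`,
`h₁(x) + h₂(y) + ⟨w, z' - z⟩ ≤ h₁(x') + h₂(y')` at feasible points of finite value. -/
lemma H_inequality {z : Sp E F} {w : Sp E F →L[ℝ] ℝ} (hw : w ∈ Q.H z) :
    Q.h₁ z.fst ≠ ⊤ ∧ Q.h₂ z.snd ≠ ⊤ ∧ ∀ z' ∈ Q.Z, Q.h₁ z'.fst ≠ ⊤ → Q.h₂ z'.snd ≠ ⊤ →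
      (Q.h₁ z.fst).toReal + (Q.h₂ z.snd).toReal + w (z' - z) ≤
        (Q.h₁ z'.fst).toReal + (Q.h₂ z'.snd).toReal := by
  obtain ⟨a, ha, a', ha', b, hb, b', hb', rfl⟩ := hw
  obtain ⟨h1, h1'⟩ := subgradient_real Q.h₁_pcc ha
  obtain ⟨h2, h2'⟩ := subgradient_real Q.h₂_pcc hb
  refine ⟨h1, h2, fun z' hz' hx hy => ?_⟩
  have e1 := h1' _ hx
  have e2 := h2' _ hy
  have e3 := ha'.2 _ hz'.1
  have e4 := hb'.2 _ hz'.2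
  simp only [pair_apply, WithLp.sub_fst, WithLp.sub_snd, add_apply]
  linarith

lemma H_monotone {z z' : Sp E F} {w w' : Sp E F →L[ℝ] ℝ} (hw : w ∈ Q.H z) (hw' : w' ∈ Q.H z') :
    0 ≤ (w - w') (z - z') := by
  obtain ⟨h1, h2, h3⟩ := Q.H_inequality hw
  obtain ⟨h1', h2', h3'⟩ := Q.H_inequality hw'
  have e1 := h3 z' (Q.mem_Z_of_mem_H hw') h1' h2'
  have e2 := h3' z (Q.mem_Z_of_mem_H hw) h1 h2
  simp only [sub_apply, map_sub] at *
  linarith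

lemma op_apply (z u : Sp E F) : Q.op z u = Q.gradX z u.fst - Q.gradY z u.snd := by
  simp [op, sub_eq_add_neg]

/-- The gradient inequalities in the two blocks, added up. -/
lemma op_inequality {μ : ℝ} (hf : Q.StronglyConvexConcave μ) {z z' : Sp E F} (hz : z ∈ Q.Z)
    (hz' : z' ∈ Q.Z) :
    Q.f (WithLp.toLp 2 (z.fst, z'.snd)) - Q.f (WithLp.toLp 2 (z'.fst, z.snd)) + μ * Q.D z' z ≤
      Q.op z (z - z') := by
  have h1 := hf.convex z hz _ hz'.1
  have h2 := hf.concave z hz _ hz'.2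
  rw [Q.D_eq_add hz, op_apply]
  simp only [WithLp.sub_fst, WithLp.sub_snd, map_sub] at *
  linarith

lemma op_monotone {μ : ℝ} (hμ : 0 ≤ μ) (hf : Q.StronglyConvexConcave μ) {z z' : Sp E F}
    (hz : z ∈ Q.Z) (hz' : z' ∈ Q.Z) : 0 ≤ (Q.op z - Q.op z') (z - z') := by
  have h1 := Q.op_inequality hf hz hz'
  have h2 := Q.op_inequality hf hz' hz
  have h3 := mul_nonneg hμ (Q.D_nonneg hz hz')
  have h4 := mul_nonneg hμ (Q.D_nonneg hz' hz)
  simp only [sub_apply, map_sub] at *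
  linarith

/-- Strong monotonicity of `F + H` at the saddle point. -/
lemma mul_D_le_of_saddle {μ : ℝ} (hf : Q.StronglyConvexConcave μ) {zs : Sp E F}
    (hzs : Q.IsSaddlePoint zs) {z : Sp E F} {w : Sp E F →L[ℝ] ℝ} (hw : w ∈ Q.H z) :
    μ * Q.D zs z ≤ (Q.op z + w) (z - zs) := by
  have hz := Q.mem_Z_of_mem_H hw
  obtain ⟨h1, h2, h3⟩ := Q.H_inequality hw
  have e1 := h3 zs hzs.mem hzs.h₁_ne_top hzs.h₂_ne_top
  have e2 := Q.op_inequality hf hz hzs.mem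
  have e3 := hzs.le_left _ hz.2
  have e4 := hzs.le_right _ hz.1
  unfold objective at e3 e4
  rw [← EReal.coe_toReal h1 (Q.h₁_pcc.ne_bot _), ← EReal.coe_toReal hzs.h₁_ne_top
    (Q.h₁_pcc.ne_bot _), ← EReal.coe_toReal hzs.h₂_ne_top (Q.h₂_pcc.ne_bot _)] at e4
  rw [← EReal.coe_toReal h2 (Q.h₂_pcc.ne_bot _), ← EReal.coe_toReal hzs.h₁_ne_top
    (Q.h₁_pcc.ne_bot _), ← EReal.coe_toReal hzs.h₂_ne_top (Q.h₂_pcc.ne_bot _)] at e3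
  norm_cast at e3 e4
  simp only [add_apply, map_sub] at *
  linarith

end SaddleProblem

/-! ### Taylor remainders -/

/-- Taylor's theorem for a chain of successive derivatives `g 0, g 1, …, g m` on `[0, 1]` whose
last member satisfies a Lipschitz bound at `0`. -/
lemma taylor_remainder_le {W : Type*} [NormedAddCommGroup W] [NormedSpace ℝ W] (m : ℕ) :
    ∀ (g : ℕ → ℝ → W) (C : ℝ),
      (∀ i < m, ∀ t ∈ Icc (0 : ℝ) 1, HasDerivAt (g i) (g (i + 1) t) t) →
      (∀ t ∈ Icc (0 : ℝ) 1, ‖g m t - g m 0‖ ≤ C * t) →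
      ∀ t ∈ Icc (0 : ℝ) 1,
        ‖g 0 t - ∑ i ∈ Finset.range (m + 1), (t ^ i / (i.factorial : ℝ)) • g i 0‖ ≤
          C * t ^ (m + 1) / ((m + 1).factorial : ℝ) := by
  induction m with
  | zero =>
    intro g C _ hC t ht
    simpa using hC t ht
  | succ m ih =>
    intro g C hd hC
    have hstep := ih (fun i => g (i + 1)) C (fun i hi => hd (i + 1) (by omega)) hC
    have hderiv : ∀ t ∈ Icc (0 : ℝ) 1, HasDerivAt
        (fun t => g 0 t - ∑ i ∈ Finset.range (m + 1 + 1), (t ^ i / (i.factorial : ℝ)) • g i 0)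
        (g 1 t - ∑ i ∈ Finset.range (m + 1), (t ^ i / (i.factorial : ℝ)) • g (i + 1) 0) t := by
      intro t ht
      refine (hd 0 (by omega) t ht).sub ?_
      have hterm : ∀ i ∈ Finset.range (m + 1 + 1), HasDerivAt
          (fun t : ℝ => (t ^ i / (i.factorial : ℝ)) • g i 0)
          (((i : ℝ) * t ^ (i - 1) / (i.factorial : ℝ)) • g i 0) t := fun i _ =>
        ((hasDerivAt_pow i t).div_const _).smul_const _
      refine (HasDerivAt.fun_sum hterm).congr_deriv ?_
      rw [Finset.sum_range_succ']
      simp only [Nat.cast_zero, zero_mul, zero_div, zero_smul, add_zero]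
      refine Finset.sum_congr rfl fun i _ => ?_
      congr 1
      have h1 : ((i + 1 : ℕ) : ℝ) ≠ 0 := by positivity
      have h2 : (i.factorial : ℝ) ≠ 0 := by positivity
      rw [Nat.factorial_succ, Nat.cast_mul, Nat.add_sub_cancel, mul_div_mul_left _ _ h1]
    have hfac : ((m + 1 + 1).factorial : ℝ) = ((m + 1 + 1 : ℕ) : ℝ) * ((m + 1).factorial : ℝ) := by
      rw [Nat.factorial_succ, Nat.cast_mul]
    refine fun t ht => image_norm_le_of_norm_deriv_right_le_deriv_boundary
      (f := fun t => g 0 t -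
        ∑ i ∈ Finset.range (m + 1 + 1), (t ^ i / (i.factorial : ℝ)) • g i 0)
      (f' := fun t => g 1 t -
        ∑ i ∈ Finset.range (m + 1), (t ^ i / (i.factorial : ℝ)) • g (i + 1) 0)
      (B := fun t => C * t ^ (m + 1 + 1) / ((m + 1 + 1).factorial : ℝ))
      (B' := fun t => C * t ^ (m + 1) / ((m + 1).factorial : ℝ))
      (fun t ht => (hderiv t ht).continuousAt.continuousWithinAt)
      (fun t ht => (hderiv t (Ico_subset_Icc_self ht)).hasDerivWithinAt) ?_ (fun t => ?_)
      (fun t ht => hstep t (Ico_subset_Icc_self ht)) ht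
    · rw [Finset.sum_range_succ']
      simp
    · refine (((hasDerivAt_pow (m + 1 + 1) t).const_mul C).div_const _).congr_deriv ?_
      have h1 : ((m + 1 + 1 : ℕ) : ℝ) ≠ 0 := by positivity
      have h2 : ((m + 1).factorial : ℝ) ≠ 0 := by positivity
      rw [hfac, Nat.add_sub_cancel]
      field_simp

namespace SaddleProblem

variable {E F : Type*} [NormedAddCommGroup E] [NormedSpace ℝ E]
  [NormedAddCommGroup F] [NormedSpace ℝ F] (Q : SaddleProblem E F)

/-- `F` is the differential of `f` precomposed with `(x, y) ↦ (x, -y)`; so it is as smooth as the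
differential. -/
lemma op_eq_comp (z : Sp E F) : Q.op z = (ContinuousLinearMap.compL ℝ (Sp E F) (Sp E F) ℝ).flip
    ((WithLp.prodContinuousLinearEquiv 2 ℝ E F).symm.toContinuousLinearMap.comp
      ((WithLp.fstL 2 ℝ E F).prod (-(WithLp.sndL 2 ℝ E F)))) (fderiv ℝ Q.f z) := by
  ext u
  rw [op_apply]
  simp only [gradX, gradY, ContinuousLinearMap.comp_apply, ContinuousLinearMap.flip_apply,
    ContinuousLinearMap.compL_apply]
  rw [← map_sub]
  congr 1
  apply WithLp.ofLp_injective
  ext <;> simp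

lemma op_contDiffAt {p : ℕ} (hp : 1 ≤ p) {L : ℝ} (hF : Q.OpSmooth p L) {z : Sp E F}
    (hz : z ∈ Q.Z) : ContDiffAt ℝ ((p - 1 : ℕ) : ℕ∞) Q.op z := by
  have h1 : ContDiffAt ℝ (p : ℕ∞) Q.f z :=
    hF.contDiffOn.contDiffAt (Q.domf_open.mem_nhds (Q.subset_domf z hz.1 hz.2))
  have h2 : ContDiffAt ℝ ((p - 1 : ℕ) : ℕ∞) (fderiv ℝ Q.f) z := by
    refine h1.fderiv_right ?_
    norm_cast
    omega
  have h3 := h2.continuousLinearMap_comp ((ContinuousLinearMap.compL ℝ (Sp E F) (Sp E F) ℝ).flip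
    ((WithLp.prodContinuousLinearEquiv 2 ℝ E F).symm.toContinuousLinearMap.comp
      ((WithLp.fstL 2 ℝ E F).prod (-(WithLp.sndL 2 ℝ E F)))))
  refine h3.congr_of_eventuallyEq (Filter.Eventually.of_forall fun z => ?_)
  exact Q.op_eq_comp z

lemma hasDerivAt_iteratedFDeriv_line {p : ℕ} (hp : 1 ≤ p) {L : ℝ} (hF : Q.OpSmooth p L)
    {z u : Sp E F} {t : ℝ} (ht : z + t • u ∈ Q.Z) {i : ℕ} (hi : i < p - 1) :
    HasDerivAt (fun t : ℝ => iteratedFDeriv ℝ i Q.op (z + t • u) fun _ => u)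
      (iteratedFDeriv ℝ (i + 1) Q.op (z + t • u) fun _ => u) t := by
  have h1 : DifferentiableAt ℝ (iteratedFDeriv ℝ i Q.op) (z + t • u) :=
    (Q.op_contDiffAt hp hF ht).differentiableAt_iteratedFDeriv (by exact_mod_cast hi)
  have h2 : HasDerivAt (fun t : ℝ => z + t • u) u t := by
    simpa using ((hasDerivAt_id t).smul_const u).const_add z
  have h3 := h1.hasFDerivAt.comp_hasDerivAt t h2
  have h4 := (ContinuousMultilinearMap.apply ℝ (fun _ : Fin i => Sp E F) (Sp E F →L[ℝ] ℝ)
    (fun _ => u)).hasFDerivAt.comp_hasDerivAt t h3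
  refine h4.congr_deriv ?_
  rw [iteratedFDeriv_succ_apply_left]
  rfl

/-- The Taylor remainder of `F` at `z`. -/
lemma norm_op_sub_taylorPoly_le {p : ℕ} (hp : 1 ≤ p) {L : ℝ} (hF : Q.OpSmooth p L)
    {z z' : Sp E F} (hz : z ∈ Q.Z) (hz' : z' ∈ Q.Z) :
    ‖Q.op z' - taylorPoly Q.op (p - 1) z' z‖ ≤ L / (p.factorial : ℝ) * ‖z' - z‖ ^ p := by
  have h := taylor_remainder_le (p - 1)
    (fun i t => iteratedFDeriv ℝ i Q.op (z + t • (z' - z)) fun _ => z' - z) (L * ‖z' - z‖ ^ p)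
    (fun i hi t ht => Q.hasDerivAt_iteratedFDeriv_line hp hF (Q.add_smul_sub_mem hz hz' ht) hi)
    (fun t ht => ?_) 1 (by simp)
  · simp only [one_smul, add_sub_cancel, zero_smul, add_zero, one_pow, mul_one,
      Nat.sub_add_cancel hp, iteratedFDeriv_zero_apply] at h
    rw [taylorPoly, Nat.sub_add_cancel hp]
    refine h.trans_eq ?_
    ring
  · have h1 := hF.lipschitz _ (Q.add_smul_sub_mem hz hz' ht) _ hz
    rw [add_sub_cancel_left, norm_smul, Real.norm_of_nonneg ht.1] at h1
    simp only [zero_smul, add_zero]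
    rw [← sub_apply]
    refine (ContinuousMultilinearMap.le_opNorm _ _).trans ?_
    rw [Finset.prod_const, Finset.card_univ, Fintype.card_fin]
    calc _ ≤ L * (t * ‖z' - z‖) * ‖z' - z‖ ^ (p - 1) := by gcongr
      _ = L * (‖z' - z‖ ^ (p - 1) * ‖z' - z‖) * t := by ring
      _ = _ := by rw [← pow_succ, Nat.sub_add_cancel hp]

/-- The Taylor remainder of `F` at `z` is locally Lipschitz, with the constant `L / (p - 1)!` times
the `(p - 1)`-st power of the distance to `z`. It is bounded as the one-dimensional Taylor remainder
of the difference of `F` along two rays from `z`. -/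
lemma norm_remainder_sub_le {p : ℕ} (hp : 2 ≤ p) {L : ℝ} (hF : Q.OpSmooth p L) (hL : 0 ≤ L)
    {z a b : Sp E F} (hz : z ∈ Q.Z) (ha : a ∈ Q.Z) (hb : b ∈ Q.Z) :
    ‖(Q.op a - taylorPoly Q.op (p - 1) a z) - (Q.op b - taylorPoly Q.op (p - 1) b z)‖ ≤
      L / ((p - 1).factorial : ℝ) * max ‖a - z‖ ‖b - z‖ ^ (p - 1) * ‖a - b‖ := by
  have hp1 : 1 ≤ p := by omega
  set M := max ‖a - z‖ ‖b - z‖ with hM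
  have hM0 : 0 ≤ M := (norm_nonneg _).trans (le_max_left _ _)
  have h := taylor_remainder_le (p - 1)
    (fun i t => (iteratedFDeriv ℝ i Q.op (z + t • (a - z)) fun _ => a - z) -
      iteratedFDeriv ℝ i Q.op (z + t • (b - z)) fun _ => b - z) (p * L * M ^ (p - 1) * ‖a - b‖)
    (fun i hi t ht =>
      (Q.hasDerivAt_iteratedFDeriv_line hp1 hF (Q.add_smul_sub_mem hz ha ht) hi).sub
        (Q.hasDerivAt_iteratedFDeriv_line hp1 hF (Q.add_smul_sub_mem hz hb ht) hi))
    (fun t ht => ?_) 1 (by simp)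
  · simp only [one_smul, add_sub_cancel, zero_smul, add_zero, one_pow, mul_one,
      Nat.sub_add_cancel hp1, iteratedFDeriv_zero_apply] at h
    simp only [smul_sub (_ / _ : ℝ), Finset.sum_sub_distrib] at h
    rw [taylorPoly, taylorPoly, Nat.sub_add_cancel hp1, sub_sub_sub_comm]
    refine h.trans_eq ?_
    have hfac : (p.factorial : ℝ) = p * ((p - 1).factorial : ℝ) := by
      rw [← Nat.mul_factorial_pred (by omega : p ≠ 0), Nat.cast_mul]
    have h1 : ((p - 1).factorial : ℝ) ≠ 0 := by positivity
    have h2 : (p : ℝ) ≠ 0 := by positivity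
    rw [hfac]
    field_simp
  · set A := iteratedFDeriv ℝ (p - 1) Q.op with hA
    have hma := Q.add_smul_sub_mem hz ha ht
    have hmb := Q.add_smul_sub_mem hz hb ht
    have h1 := hF.lipschitz _ hma _ hmb
    have h2 := hF.lipschitz _ hmb _ hz
    rw [← hA] at h1 h2
    rw [show z + t • (a - z) - (z + t • (b - z)) = t • (a - b) by module, norm_smul,
      Real.norm_of_nonneg ht.1] at h1
    rw [add_sub_cancel_left, norm_smul, Real.norm_of_nonneg ht.1] at h2
    simp only [zero_smul, add_zero]
    have e1 : ‖(A (z + t • (a - z)) - A (z + t • (b - z))) fun _ => a - z‖ ≤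
        L * (t * ‖a - b‖) * M ^ (p - 1) := by
      refine (ContinuousMultilinearMap.le_opNorm _ _).trans ?_
      rw [Finset.prod_const, Finset.card_univ, Fintype.card_fin]
      have := ht.1
      gcongr
      exact le_max_left _ _
    have e2 : ‖((A (z + t • (b - z)) - A z) fun _ => a - z) -
        (A (z + t • (b - z)) - A z) fun _ => b - z‖ ≤
        (p - 1 : ℕ) * (L * t) * M ^ (p - 1) * ‖a - b‖ := by
      refine (ContinuousMultilinearMap.norm_image_sub_le _ _ _).trans ?_
      have hne : Nonempty (Fin (p - 1)) := ⟨⟨0, by omega⟩⟩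
      have hsub : ((fun _ => a - z) - fun _ => b - z : Fin (p - 1) → Sp E F) =
          fun _ => a - b := by
        funext i
        simp
      rw [Fintype.card_fin, hsub, pi_norm_const, pi_norm_const, pi_norm_const, ← hM]
      calc _ ≤ L * (t * M) * (p - 1 : ℕ) * M ^ (p - 1 - 1) * ‖a - b‖ := by
            gcongr
            refine h2.trans ?_
            have := ht.1
            gcongr
            exact le_max_right _ _
        _ = (p - 1 : ℕ) * (L * t) * (M ^ (p - 1 - 1) * M) * ‖a - b‖ := by ring
        _ = _ := by rw [← pow_succ, show p - 1 - 1 + 1 = p - 1 by omega]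
    have e3 : ((A (z + t • (a - z)) fun _ => a - z) - A (z + t • (b - z)) fun _ => b - z) -
        ((A z fun _ => a - z) - A z fun _ => b - z) =
        ((A (z + t • (a - z)) - A (z + t • (b - z))) fun _ => a - z) +
        (((A (z + t • (b - z)) - A z) fun _ => a - z) -
        (A (z + t • (b - z)) - A z) fun _ => b - z) := by
      simp only [sub_apply]
      abel
    rw [e3]
    refine (norm_add_le _ _).trans ((add_le_add e1 e2).trans_eq ?_)
    rw [Nat.cast_sub hp1]
    push_cast
    ring

end SaddleProblem

namespace SaddleProblem

variable {E F : Type*} [NormedAddCommGroup E] [NormedSpace ℝ E]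
  [NormedAddCommGroup F] [NormedSpace ℝ F] (Q : SaddleProblem E F)

/-! ### The regularized Taylor expansion -/

/-- The regularizer is monotone, with a modulus governed by the smaller of its two weights. -/
lemma regularizer_monotone {z a b : Sp E F} (ha : a ∈ Q.Z) (hb : b ∈ Q.Z)
    (hz : z ∈ Q.Z) {s : ℝ} (hs : 0 ≤ s) :
    min ((2 * Q.D a z) ^ s) ((2 * Q.D b z) ^ s) * ‖a - b‖ ^ 2 ≤
      ((2 * Q.D a z) ^ s • (Q.gradΦ a - Q.gradΦ z) -
        (2 * Q.D b z) ^ s • (Q.gradΦ b - Q.gradΦ z)) (a - b) := by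
  have h1 := Q.gradΦ_sub_apply z b a
  have h2 := Q.gradΦ_sub_apply z a b
  have h3 := Q.sq_le_gradΦ_sub ha hb
  have h4 := Q.D_nonneg hb ha
  have h5 := Q.D_nonneg ha hb
  have h6 := Q.D_nonneg hz ha
  have h7 := Q.D_nonneg hz hb
  have hA : 0 ≤ (2 * Q.D a z) ^ s := by positivity
  have hB : 0 ≤ (2 * Q.D b z) ^ s := by positivity
  simp only [sub_apply, smul_apply, smul_eq_mul, map_sub] at *
  rcases le_total (Q.D a z) (Q.D b z) with hle | hle
  · have hAB : (2 * Q.D a z) ^ s ≤ (2 * Q.D b z) ^ s :=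
      Real.rpow_le_rpow (by positivity) (by linarith) hs
    rw [min_eq_left hAB]
    nlinarith [mul_le_mul_of_nonneg_left h3 hA]
  · have hAB : (2 * Q.D b z) ^ s ≤ (2 * Q.D a z) ^ s :=
      Real.rpow_le_rpow (by positivity) (by linarith) hs
    rw [min_eq_right hAB]
    nlinarith [mul_le_mul_of_nonneg_left h3 hB]

lemma norm_pow_le_two_mul_D_rpow {p : ℕ} (hp : 1 ≤ p) {z a : Sp E F} (ha : a ∈ Q.Z)
    (hz : z ∈ Q.Z) : ‖a - z‖ ^ (p - 1) ≤ (2 * Q.D a z) ^ (((p : ℝ) - 1) / 2) := by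
  have h1 := Q.half_sq_le_D hz ha
  have hp' : (1 : ℝ) ≤ p := by exact_mod_cast hp
  calc ‖a - z‖ ^ (p - 1) = (‖a - z‖ ^ 2) ^ (((p : ℝ) - 1) / 2) := by
        rw [← Real.rpow_natCast, ← Real.rpow_natCast, ← Real.rpow_mul (norm_nonneg _),
          Nat.cast_sub hp]
        push_cast
        ring_nf
    _ ≤ _ := Real.rpow_le_rpow (by positivity) (by linarith) (by linarith)

/-- The regularized Taylor expansion is monotone up to a cubic error: the derivative of the
regularizer dominates that of the Taylor remainder because `L ≤ λ`. -/
lemma regTaylor_almost_monotone {p : ℕ} (hp : 2 ≤ p) {μ L lam : ℝ} (hμ : 0 ≤ μ)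
    (hf : Q.StronglyConvexConcave μ) (hF : Q.OpSmooth p L) (hL : 0 ≤ L) (hlam : L ≤ lam)
    {z a b : Sp E F} (hz : z ∈ Q.Z) (ha : a ∈ Q.Z) (hb : b ∈ Q.Z) {M : ℝ}
    (haM : ‖a - z‖ ≤ M) (hbM : ‖b - z‖ ≤ M) :
    -(lam / ((p - 1).factorial : ℝ) * ((p - 1 : ℕ) * M ^ (p - 1 - 1)) * ‖a - b‖ ^ 3) ≤
      (Q.regTaylor p lam a z - Q.regTaylor p lam b z) (a - b) := by
  have hp' : (2 : ℝ) ≤ p := by exact_mod_cast hp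
  have hlam0 : 0 ≤ lam := hL.trans hlam
  set κ := lam / ((p - 1).factorial : ℝ) with hκ
  have hκ0 : 0 ≤ κ := by positivity
  set m := min ‖a - z‖ ‖b - z‖ with hm
  set x := max ‖a - z‖ ‖b - z‖ with hx
  have hm0 : 0 ≤ m := le_min (norm_nonneg _) (norm_nonneg _)
  have hmx : m ≤ x := min_le_max
  have hxM : x ≤ M := max_le haM hbM
  have hxm : x - m ≤ ‖a - b‖ := by
    have h := abs_norm_sub_norm_le (a - z) (b - z)
    rw [sub_sub_sub_cancel_right] at h
    rwa [hx, hm, max_sub_min_eq_abs, abs_sub_comm]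
  have hpow : x ^ (p - 1) - m ^ (p - 1) ≤ (p - 1 : ℕ) * M ^ (p - 1 - 1) * ‖a - b‖ := by
    have h := abs_pow_sub_pow_le x m (p - 1)
    have hmax : max |x| |m| = x := by
      rw [abs_of_nonneg hm0, abs_of_nonneg (hm0.trans hmx), max_eq_left hmx]
    rw [hmax, abs_of_nonneg (sub_nonneg.2 hmx)] at h
    refine (le_abs_self _).trans (h.trans ?_)
    have hx0 := hm0.trans hmx
    calc (x - m) * ((p - 1 : ℕ) : ℝ) * x ^ (p - 1 - 1)
        ≤ ‖a - b‖ * ((p - 1 : ℕ) : ℝ) * M ^ (p - 1 - 1) := by gcongr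
      _ = _ := by ring
  have hreg := Q.regularizer_monotone ha hb hz (s := ((p : ℝ) - 1) / 2) (by linarith)
  have hmin : m ^ (p - 1) ≤ min ((2 * Q.D a z) ^ (((p : ℝ) - 1) / 2))
      ((2 * Q.D b z) ^ (((p : ℝ) - 1) / 2)) := by
    refine le_min ?_ ?_
    · exact (pow_le_pow_left₀ hm0 (min_le_left _ _) _).trans
        (Q.norm_pow_le_two_mul_D_rpow (by omega) ha hz)
    · exact (pow_le_pow_left₀ hm0 (min_le_right _ _) _).trans
        (Q.norm_pow_le_two_mul_D_rpow (by omega) hb hz)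
  have hreg' := (mul_le_mul_of_nonneg_right hmin (sq_nonneg ‖a - b‖)).trans hreg
  have hop := Q.op_monotone hμ hf ha hb
  have hrem := Q.norm_remainder_sub_le hp hF hL hz ha hb
  have hrem2 := (le_abs_self _).trans
    (((Q.op a - taylorPoly Q.op (p - 1) a z) -
      (Q.op b - taylorPoly Q.op (p - 1) b z)).le_opNorm (a - b))
  have hLκ : L / ((p - 1).factorial : ℝ) ≤ κ := by rw [hκ]; gcongr
  have hrem3 : ((Q.op a - taylorPoly Q.op (p - 1) a z) -
      (Q.op b - taylorPoly Q.op (p - 1) b z)) (a - b) ≤ κ * x ^ (p - 1) * ‖a - b‖ ^ 2 := by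
    refine hrem2.trans ?_
    have hx0 := hm0.trans hmx
    calc _ ≤ (κ * x ^ (p - 1) * ‖a - b‖) * ‖a - b‖ := by
          gcongr
          exact hrem.trans (by gcongr)
      _ = _ := by ring
  have hsplit : (Q.regTaylor p lam a z - Q.regTaylor p lam b z) (a - b) =
      (Q.op a - Q.op b) (a - b) - ((Q.op a - taylorPoly Q.op (p - 1) a z) -
      (Q.op b - taylorPoly Q.op (p - 1) b z)) (a - b) +
      κ * ((2 * Q.D a z) ^ (((p : ℝ) - 1) / 2) • (Q.gradΦ a - Q.gradΦ z) -
        (2 * Q.D b z) ^ (((p : ℝ) - 1) / 2) • (Q.gradΦ b - Q.gradΦ z)) (a - b) := by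
    simp only [regTaylor, sub_apply, add_apply, smul_apply, smul_eq_mul]
    rw [← hκ]
    ring
  rw [hsplit]
  have h1 := mul_le_mul_of_nonneg_left hreg' hκ0
  have h2 := mul_le_mul_of_nonneg_left
    (mul_le_mul_of_nonneg_right hpow (sq_nonneg ‖a - b‖)) hκ0
  nlinarith

end SaddleProblem

/-- An operator that is monotone up to a cubic error on pairs of points of a segment is monotone on
the endpoints of the segment: subdivide it into `n` parts and let `n → ∞`. -/
lemma monotone_of_almost_monotone {V : Type*} [NormedAddCommGroup V] [NormedSpace ℝ V]
    (T : V → V →L[ℝ] ℝ) (a b : V) (C : ℝ)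
    (h : ∀ s ∈ Icc (0 : ℝ) 1, ∀ t ∈ Icc (0 : ℝ) 1,
      -(C * ‖(a + s • (b - a)) - (a + t • (b - a))‖ ^ 3) ≤
        (T (a + s • (b - a)) - T (a + t • (b - a))) ((a + s • (b - a)) - (a + t • (b - a)))) :
    0 ≤ (T b - T a) (b - a) := by
  have key : ∀ n : ℕ, -(C * ‖b - a‖ ^ 3) * (1 / ((n : ℝ) + 1)) ≤ (T b - T a) (b - a) := by
    intro n
    have hn : (0 : ℝ) < (n : ℝ) + 1 := by positivity
    have hstep : ∀ j ∈ Finset.range (n + 1), -(C * ‖b - a‖ ^ 3) * (1 / ((n : ℝ) + 1)) ^ 2 ≤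
        T (a + (((j + 1 : ℕ) : ℝ) / (n + 1)) • (b - a)) (b - a) -
          T (a + (((j : ℕ) : ℝ) / (n + 1)) • (b - a)) (b - a) := by
      intro j hj
      have hj' : (j : ℝ) + 1 ≤ n + 1 := by exact_mod_cast Finset.mem_range.1 hj
      have h1 := h (((j + 1 : ℕ) : ℝ) / (n + 1))
        ⟨by positivity, by rw [div_le_one hn]; push_cast; exact hj'⟩ ((j : ℝ) / (n + 1))
        ⟨by positivity, by rw [div_le_one hn]; linarith⟩
      have h2 : a + (((j + 1 : ℕ) : ℝ) / (n + 1)) • (b - a) - (a + ((j : ℝ) / (n + 1)) • (b - a)) =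
          (1 / ((n : ℝ) + 1)) • (b - a) := by
        rw [add_sub_add_left_eq_sub, ← sub_smul]
        congr 1
        push_cast
        field_simp
        ring
      rw [h2, norm_smul, Real.norm_of_nonneg (by positivity), map_smul, smul_eq_mul,
        sub_apply] at h1
      have h3 : 0 < 1 / ((n : ℝ) + 1) := by positivity
      refine le_of_mul_le_mul_left ?_ h3
      calc _ = -(C * (1 / ((n : ℝ) + 1) * ‖b - a‖) ^ 3) := by ring
        _ ≤ _ := h1
    have hsum := Finset.sum_le_sum hstep
    rw [Finset.sum_range_sub
      (fun j : ℕ => T (a + ((j : ℝ) / ((n : ℝ) + 1)) • (b - a)) (b - a)), Finset.sum_const,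
      Finset.card_range, nsmul_eq_mul] at hsum
    have e1 : ((n + 1 : ℕ) : ℝ) / ((n : ℝ) + 1) = 1 := by
      push_cast
      exact div_self hn.ne'
    rw [e1] at hsum
    simp only [one_smul, add_sub_cancel, Nat.cast_zero, zero_div, zero_smul, add_zero] at hsum
    rw [sub_apply]
    refine le_trans (le_of_eq ?_) hsum
    push_cast
    field_simp
  have hlim : Filter.Tendsto (fun n : ℕ => -(C * ‖b - a‖ ^ 3) * (1 / ((n : ℝ) + 1)))
      Filter.atTop (nhds 0) := by
    simpa using tendsto_one_div_add_atTop_nhds_zero_nat.const_mul (-(C * ‖b - a‖ ^ 3))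
  exact le_of_tendsto' hlim key

namespace SaddleProblem

variable {E F : Type*} [NormedAddCommGroup E] [NormedSpace ℝ E]
  [NormedAddCommGroup F] [NormedSpace ℝ F] (Q : SaddleProblem E F)

lemma regTaylor_monotone {p : ℕ} (hp : 2 ≤ p) {μ L lam : ℝ} (hμ : 0 ≤ μ)
    (hf : Q.StronglyConvexConcave μ) (hF : Q.OpSmooth p L) (hL : 0 ≤ L) (hlam : L ≤ lam)
    {z a b : Sp E F} (hz : z ∈ Q.Z) (ha : a ∈ Q.Z) (hb : b ∈ Q.Z) :
    0 ≤ (Q.regTaylor p lam b z - Q.regTaylor p lam a z) (b - a) := by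
  have hM : ∀ t ∈ Icc (0 : ℝ) 1, ‖a + t • (b - a) - z‖ ≤ ‖a - z‖ + ‖b - a‖ := by
    intro t ht
    rw [show a + t • (b - a) - z = (a - z) + t • (b - a) by abel]
    refine (norm_add_le _ _).trans ?_
    rw [norm_smul, Real.norm_of_nonneg ht.1]
    gcongr
    exact mul_le_of_le_one_left (norm_nonneg _) ht.2
  exact monotone_of_almost_monotone (fun x => Q.regTaylor p lam x z) a b _
    fun s hs t ht => Q.regTaylor_almost_monotone hp hμ hf hF hL hlam hz
      (Q.add_smul_sub_mem ha hb hs) (Q.add_smul_sub_mem ha hb ht) (hM s hs) (hM t ht)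

/-- The error of the regularized Taylor expansion. -/
lemma norm_op_sub_regTaylor_le {p : ℕ} (hp : 1 ≤ p) {L LΦ lam : ℝ} (hF : Q.OpSmooth p L)
    (hΦ : Q.MirrorSmooth LΦ) (hLΦ : 0 < LΦ) (hlam : 0 ≤ lam) {z z' : Sp E F}
    (hz : z ∈ Q.Z) (hz' : z' ∈ Q.Z) :
    ‖Q.op z' - Q.regTaylor p lam z' z‖ ≤
      effLip p L LΦ lam / (p.factorial : ℝ) * ‖z' - z‖ ^ p := by
  have hp' : (1 : ℝ) ≤ p := by exact_mod_cast hp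
  have h1 := Q.norm_op_sub_taylorPoly_le hp hF hz hz'
  have h2 := hΦ _ hz' _ hz
  have hD := Q.D_nonneg hz hz'
  have h3 : (2 * Q.D z' z) ^ (((p : ℝ) - 1) / 2) ≤
      LΦ ^ (((p : ℝ) - 1) / 2) * ‖z' - z‖ ^ (p - 1) := by
    calc (2 * Q.D z' z) ^ (((p : ℝ) - 1) / 2) ≤ (LΦ * ‖z' - z‖ ^ 2) ^ (((p : ℝ) - 1) / 2) :=
          Real.rpow_le_rpow (by positivity) (Q.D_le hΦ hz hz') (by linarith)
      _ = _ := by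
        rw [Real.mul_rpow hLΦ.le (by positivity), ← Real.rpow_natCast, ← Real.rpow_natCast,
          ← Real.rpow_mul (norm_nonneg _), Nat.cast_sub hp]
        push_cast
        ring_nf
  have hfac : (p.factorial : ℝ) = p * ((p - 1).factorial : ℝ) := by
    rw [← Nat.mul_factorial_pred (by omega : p ≠ 0), Nat.cast_mul]
  have hLpow : LΦ ^ (((p : ℝ) + 1) / 2) = LΦ ^ (((p : ℝ) - 1) / 2) * LΦ := by
    rw [← Real.rpow_add_one hLΦ.ne']
    ring_nf
  have hpow : ‖z' - z‖ ^ p = ‖z' - z‖ ^ (p - 1) * ‖z' - z‖ := by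
    rw [← pow_succ, Nat.sub_add_cancel hp]
  rw [regTaylor, ← sub_sub]
  refine (norm_sub_le _ _).trans ?_
  rw [norm_smul, Real.norm_of_nonneg (by positivity)]
  calc _ ≤ L / (p.factorial : ℝ) * ‖z' - z‖ ^ p + lam / ((p - 1).factorial : ℝ) *
        (LΦ ^ (((p : ℝ) - 1) / 2) * ‖z' - z‖ ^ (p - 1)) * (LΦ * ‖z' - z‖) := by gcongr
    _ = _ := by
      have h4 : ((p - 1).factorial : ℝ) ≠ 0 := by positivity
      have h5 : (p : ℝ) ≠ 0 := by positivity
      rw [effLip, hfac, hLpow, hpow]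
      field_simp

/-! ### Solutions of the subproblem -/

/-- The regularized subproblem is strongly monotone, so its solution is unique. -/
lemma IsSubsolution.unique {A : Params} (hp : 2 ≤ A.p) {μ L : ℝ} (hμ : 0 ≤ μ)
    (hf : Q.StronglyConvexConcave μ) (hF : Q.OpSmooth A.p L) (hL : 0 ≤ L) (hlam : L ≤ A.lam)
    {z a b : Sp E F} {v : Sp E F →L[ℝ] ℝ} {t : ℝ} (ht : 0 ≤ t) (hz : z ∈ Q.Z)
    (ha : Q.IsSubsolution A z v t a) (hb : Q.IsSubsolution A z v t b) : a = b := by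
  obtain ⟨w, hw, ea⟩ := ha
  obtain ⟨w', hw', eb⟩ := hb
  have ha := Q.mem_Z_of_mem_H hw
  have hb := Q.mem_Z_of_mem_H hw'
  have h1 := mul_nonneg ht (Q.regTaylor_monotone hp hμ hf hF hL hlam hz hb ha)
  have h2 := mul_nonneg ht (Q.H_monotone hw hw')
  have h3 := Q.sq_le_gradΦ_sub ha hb
  have ea' := congrArg (fun g : Sp E F →L[ℝ] ℝ => g (a - b)) ea
  have eb' := congrArg (fun g : Sp E F →L[ℝ] ℝ => g (a - b)) eb
  simp only [sub_apply, add_apply, smul_apply, smul_eq_mul, zero_apply] at *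
  have h4 : ‖a - b‖ ^ 2 ≤ 0 := by linarith
  have h5 : ‖a - b‖ = 0 := by
    have := le_antisymm h4 (sq_nonneg _)
    simpa using this
  exact sub_eq_zero.1 (norm_eq_zero.1 h5)

/-- Lengthening the stepsize from `t` to `t'` moves the solution of the subproblem away from `z`
by a controlled amount. -/
lemma IsSubsolution.norm_sub_le {A : Params} (hp : 2 ≤ A.p) {μ L LΦ : ℝ} (hμ : 0 ≤ μ)
    (hf : Q.StronglyConvexConcave μ) (hF : Q.OpSmooth A.p L) (hL : 0 ≤ L) (hlam : L ≤ A.lam)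
    (hΦ : Q.MirrorSmooth LΦ)
    {z a b : Sp E F} {v : Sp E F →L[ℝ] ℝ} {t t' : ℝ} (ht : 0 < t) (htt' : t ≤ t')
    (hz : z ∈ Q.Z) (ha : Q.IsSubsolution A z v t a) (hb : Q.IsSubsolution A z v t' b) :
    ‖b - z‖ ≤ (1 + (t' / t - 1) * LΦ) * ‖a - z‖ + (t' / t - 1) * ‖v‖ := by
  obtain ⟨w, hw, ea⟩ := ha
  obtain ⟨w', hw', eb⟩ := hb
  have ha := Q.mem_Z_of_mem_H hw
  have hb := Q.mem_Z_of_mem_H hw'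
  have ht' : 0 < t' := ht.trans_le htt'
  set g := v + (Q.gradΦ a - Q.gradΦ z) with hg
  have hgn : ‖g‖ ≤ ‖v‖ + LΦ * ‖a - z‖ :=
    (norm_add_le _ _).trans (add_le_add le_rfl (hΦ _ ha _ hz))
  have h1 := mul_nonneg (mul_nonneg ht.le ht'.le)
    (Q.regTaylor_monotone hp hμ hf hF hL hlam hz ha hb)
  have h2 := mul_nonneg (mul_nonneg ht.le ht'.le) (Q.H_monotone hw' hw)
  have h3 := mul_le_mul_of_nonneg_left (Q.sq_le_gradΦ_sub hb ha) ht.le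
  have h4 := mul_le_mul_of_nonneg_left ((le_abs_self _).trans (g.le_opNorm (b - a)))
    (sub_nonneg.2 htt')
  have ea' := congrArg (fun g : Sp E F →L[ℝ] ℝ => t' * g (b - a)) ea
  have eb' := congrArg (fun g : Sp E F →L[ℝ] ℝ => t * g (b - a)) eb
  simp only [hg, sub_apply, add_apply, smul_apply, smul_eq_mul, zero_apply] at h1 h2 h3 h4 ea' eb'
  rw [← hg] at h4
  -- the distance of the two solutions is at most `(t' / t - 1) ‖v + ∇Φ(a) - ∇Φ(z)‖`
  have h5 : t * ‖b - a‖ ^ 2 ≤ (t' - t) * (‖g‖ * ‖b - a‖) := by linarith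
  have h6 : ‖b - a‖ ≤ (t' / t - 1) * ‖g‖ := by
    have e : (t' / t - 1) * ‖g‖ = (t' - t) * ‖g‖ / t := by field_simp
    rw [e, le_div_iff₀ ht]
    rcases (norm_nonneg (b - a)).eq_or_lt with h0 | h0
    · rw [← h0]
      have := mul_nonneg (sub_nonneg.2 htt') (norm_nonneg g)
      linarith
    · refine le_of_mul_le_mul_right ?_ h0
      linarith
  have hρ : 0 ≤ t' / t - 1 := by
    rw [sub_nonneg, le_div_iff₀ ht]
    linarith
  calc ‖b - z‖ = ‖(b - a) + (a - z)‖ := by rw [sub_add_sub_cancel]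
    _ ≤ ‖b - a‖ + ‖a - z‖ := norm_add_le _ _
    _ ≤ (t' / t - 1) * (‖v‖ + LΦ * ‖a - z‖) + ‖a - z‖ := by
      gcongr
      exact h6.trans (by gcongr)
    _ = _ := by ring

end SaddleProblem

/-! ### The line search -/

lemma BisectionLoop.spec {adm inadm : ℝ → Prop} {β lo up r : ℝ}
    (h : BisectionLoop adm inadm β lo up r) (hlo : 0 < lo) (hle : lo ≤ up) (ha : adm lo)
    (hi : inadm up) :
    0 < r ∧ adm r ∧ ∃ t, r ≤ t ∧ t / r ≤ 1 / β ∧ inadm t := by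
  have hsqrt : ∀ lo up : ℝ, 0 < lo → lo ≤ up → lo ≤ √(lo * up) ∧ √(lo * up) ≤ up := by
    intro lo up hlo hle
    refine ⟨Real.le_sqrt_of_sq_le ?_, Real.sqrt_le_iff.2 ⟨by linarith, ?_⟩⟩ <;> nlinarith
  induction h with
  | exit lo up hr => exact ⟨hlo, ha, up, hle, hr, hi⟩
  | raise lo up r _ hadm _ ih =>
    exact ih (hlo.trans_le (hsqrt lo up hlo hle).1) (hsqrt lo up hlo hle).2 hadm hi
  | lower lo up r _ hin _ ih => exact ih hlo (hsqrt lo up hlo hle).1 ha hin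

lemma BacktrackLoop.spec {adm inadm : ℝ → Prop} {β σ up η lo' up' : ℝ}
    (h : BacktrackLoop adm inadm β σ up η lo' up') (hβ₀ : 0 < β) (hβ₁ : β ≤ 1) (hσ : 0 < σ)
    (hη : 0 < η) (hησ : η ≤ σ) (hle : η ≤ up) (hi : inadm up) :
    0 < lo' ∧ lo' ≤ up' ∧ adm lo' ∧ inadm up' := by
  induction h with
  | exit up η hadm => exact ⟨hη, hle, hadm, hi⟩
  | step up η lo' up' hin _ ih =>
    have h1 : β * η ^ 2 / σ ≤ η := by
      rw [div_le_iff₀ hσ]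
      nlinarith [mul_le_mul hβ₁ hησ hη.le zero_le_one]
    exact ih (by positivity) (h1.trans hησ) h1 hin

lemma AdvanceLoop.spec {adm inadm small large : ℝ → Prop} {β σ lo η lo' up' : ℝ}
    (h : AdvanceLoop adm inadm small large β σ lo η lo' up') (hβ₀ : 0 < β) (hβ₁ : β ≤ 1)
    (hσ : 0 < σ) (hσlo : σ ≤ lo) (hle : lo ≤ η) (ha : adm lo) :
    0 < lo' ∧ lo' ≤ up' ∧ adm lo' ∧ (small lo' ∨ inadm up') := by
  induction h with
  | exit lo η hor => exact ⟨hσ.trans_le hσlo, hle, ha, hor⟩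
  | step lo η lo' up' _ hadm _ ih =>
    have h1 : η ≤ η ^ 2 / (β * σ) := by
      rw [le_div_iff₀ (by positivity)]
      nlinarith [mul_le_mul hβ₁ (hσlo.trans hle) hσ.le zero_le_one]
    exact ih (hσlo.trans hle) h1 hadm

/-- The stepsize returned by the line search is admissible, and unless the residual is small
already, some inadmissible stepsize exceeds it by a factor of at most `1 / β`. -/
lemma LineSearch.spec {adm inadm small large : ℝ → Prop} {β σ η : ℝ}
    (h : LineSearch adm inadm small large β σ η) (hβ₀ : 0 < β) (hβ₁ : β ≤ 1) (hσ : 0 < σ)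
    (hexcl : ∀ t, 0 < t → small t → ¬ large t) :
    0 < η ∧ adm η ∧ (small η ∨ ∃ t, η ≤ t ∧ t / η ≤ 1 / β ∧ inadm t) := by
  have hβσ : β * σ ≤ σ := mul_le_of_le_one_left hσ.le hβ₁
  have hσβ : σ ≤ σ / β := le_div_self hσ.le hβ₀ hβ₁
  cases h with
  | backtrack lo up η hin hback hbis =>
    obtain ⟨h1, h2, h3, h4⟩ := hback.spec hβ₀ hβ₁ hσ (by positivity) hβσ hβσ hin
    obtain ⟨h5, h6, h7⟩ := hbis.spec h1 h2 h3 h4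
    exact ⟨h5, h6, Or.inr h7⟩
  | accept lo up hadm hadv hs =>
    obtain ⟨h1, h2, h3, h4⟩ := hadv.spec hβ₀ hβ₁ hσ le_rfl hσβ hadm
    exact ⟨h1, h3, Or.inl hs⟩
  | advance lo up η hadm hadv hl hbis =>
    obtain ⟨h1, h2, h3, h4⟩ := hadv.spec hβ₀ hβ₁ hσ le_rfl hσβ hadm
    obtain ⟨h5, h6, h7⟩ := hbis.spec h1 h2 h3 (h4.resolve_left fun hs => hexcl _ h1 hs hl)
    exact ⟨h5, h6, Or.inr h7⟩

namespace SaddleProblem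

variable {E F : Type*} [NormedAddCommGroup E] [NormedSpace ℝ E]
  [NormedAddCommGroup F] [NormedSpace ℝ F] (Q : SaddleProblem E F)

/-- The outcome of one iteration that does not return: the new point passes the stepsize test, and
the stepsize is not much shorter than an inadmissible one, hence bounded from below. -/
lemma LineSearchReturns.spec {A : Params} (hp : 3 ≤ A.p) {Lp LΦ : ℝ} (hμ : 0 ≤ A.μ)
    (hf : Q.StronglyConvexConcave A.μ) (hF : Q.OpSmooth A.p Lp) (hLp : 0 ≤ Lp)
    (hlam : Lp ≤ A.lam) (hΦ : Q.MirrorSmooth LΦ) (hLΦ : 0 < LΦ) (hα : 0 < A.α)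
    (hβ₀ : 0 < A.β) (hβ₁ : A.β ≤ 1) {z z' : Sp E F} {v : Sp E F →L[ℝ] ℝ} {σ η : ℝ} (hσ : 0 < σ)
    (hz : z ∈ Q.Z) (h : Q.LineSearchReturns A z v σ η) (hsub : 0 < η → Q.IsSubsolution A z v η z') :
    0 < η ∧ Q.StepTest A z η z' ∧ (Q.res z' ≤ ENNReal.ofReal A.ε ∨
      1 / η ≤ effLip A.p Lp LΦ A.lam * (2 / ((A.p.factorial : ℝ) * A.α * A.β ^ A.p)) *
        (LΦ ^ ((3 : ℝ) / 2) * ‖z' - z‖ + (A.β + LΦ ^ ((1 : ℝ) / 2)) * ‖v‖) ^ (A.p - 1)) := by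
  have huniq : ∀ t, 0 < t → ∀ a b, Q.IsSubsolution A z v t a → Q.IsSubsolution A z v t b → a = b :=
    fun t ht a b ha hb => ha.unique Q (by omega) hμ hf hF hLp hlam ht.le hz hb
  obtain ⟨hη, ⟨a, ha, hat⟩, hor⟩ := LineSearch.spec h hβ₀ hβ₁ hσ (by
    rintro t ht ⟨a, ha, hra⟩ ⟨b, hb, hrb⟩
    rw [huniq t ht a b ha hb] at hra
    exact absurd hra (not_le.2 hrb))
  have hz' := hsub hη
  refine ⟨hη, huniq η hη a z' ha hz' ▸ hat, ?_⟩
  rcases hor with ⟨b, hb, hrb⟩ | ⟨t, hηt, htη, b, hb, hbt⟩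
  · exact Or.inl (huniq η hη b z' hb hz' ▸ hrb)
  right
  have ht : 0 < t := hη.trans_le hηt
  obtain ⟨w, hw, -⟩ := id hb
  have hbZ := Q.mem_Z_of_mem_H hw
  have hlam0 : 0 ≤ A.lam := hLp.trans hlam
  have herr := Q.norm_op_sub_regTaylor_le (by omega) hF hΦ hLΦ hlam0 hz hbZ
  set L := effLip A.p Lp LΦ A.lam with hL
  have hL0 : 0 ≤ L := by
    rw [hL, effLip]
    positivity
  have hne : b ≠ z := by
    rintro rfl
    apply hbt
    rw [sub_self, norm_zero, zero_pow (by omega), mul_zero] at herr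
    rw [StepTest, le_antisymm herr (norm_nonneg _), sub_self, norm_zero, mul_zero, mul_zero]
  have hd : 0 < ‖b - z‖ := norm_pos_iff.2 (sub_ne_zero.2 hne)
  have hL1 : 1 ≤ LΦ := Q.one_le_of_ne hΦ hz hbZ hne
  have hdist := hz'.norm_sub_le Q (by omega) hμ hf hF hLp hlam hΦ hη hηt hz hb
  set y := LΦ ^ ((3 : ℝ) / 2) * ‖z' - z‖ + (A.β + LΦ ^ ((1 : ℝ) / 2)) * ‖v‖ with hy
  have hρ : t / η - 1 ≤ 1 / A.β - 1 := by linarith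
  have hL32 : LΦ ≤ LΦ ^ ((3 : ℝ) / 2) := Real.self_le_rpow_of_one_le hL1 (by norm_num)
  have hL12 : 0 ≤ LΦ ^ ((1 : ℝ) / 2) := by positivity
  have hβy : A.β * ‖b - z‖ ≤ y := by
    have e1 : A.β * (1 + (t / η - 1) * LΦ) ≤ LΦ ^ ((3 : ℝ) / 2) := by
      have : A.β * (1 + (t / η - 1) * LΦ) ≤ A.β * (1 + (1 / A.β - 1) * LΦ) := by gcongr
      have e : A.β * (1 + (1 / A.β - 1) * LΦ) = A.β + (1 - A.β) * LΦ := by field_simp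
      nlinarith
    have e2 : A.β * (t / η - 1) ≤ A.β + LΦ ^ ((1 : ℝ) / 2) := by
      have : A.β * (t / η - 1) ≤ A.β * (1 / A.β - 1) := by gcongr
      have e : A.β * (1 / A.β - 1) = 1 - A.β := by field_simp
      have h1 : 1 ≤ LΦ ^ ((1 : ℝ) / 2) := Real.one_le_rpow hL1 (by norm_num)
      linarith
    calc A.β * ‖b - z‖ ≤ A.β * ((1 + (t / η - 1) * LΦ) * ‖z' - z‖ + (t / η - 1) * ‖v‖) := by
          gcongr
      _ = A.β * (1 + (t / η - 1) * LΦ) * ‖z' - z‖ + A.β * (t / η - 1) * ‖v‖ := by ring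
      _ ≤ y := by rw [hy]; gcongr
  -- the failure of the stepsize test at `t`, after division by `‖b - z‖`
  have hfail : A.α / 2 ≤ t * (L / (A.p.factorial : ℝ)) * ‖b - z‖ ^ (A.p - 1) := by
    have h1 := (lt_of_not_ge hbt).le.trans (mul_le_mul_of_nonneg_left herr ht.le)
    refine le_of_mul_le_mul_right ?_ hd
    calc A.α / 2 * ‖b - z‖ ≤ t * (L / (A.p.factorial : ℝ) * ‖b - z‖ ^ A.p) := h1
      _ = _ := by
        rw [mul_assoc (t * _), ← pow_succ, Nat.sub_add_cancel (by omega)]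
        ring
  have hβt : A.β * t ≤ η := by
    rw [div_le_div_iff₀ hη hβ₀] at htη
    linarith
  have hpow : A.β ^ A.p = A.β * A.β ^ (A.p - 1) := by
    rw [← pow_succ', Nat.sub_add_cancel (by omega)]
  have hy0 : 0 ≤ y := le_trans (by positivity) hβy
  have hmain : A.α / 2 * A.β ^ A.p ≤ η * (L / (A.p.factorial : ℝ)) * y ^ (A.p - 1) := by
    calc A.α / 2 * A.β ^ A.p
        ≤ t * (L / (A.p.factorial : ℝ)) * ‖b - z‖ ^ (A.p - 1) * A.β ^ A.p := by gcongr
      _ = (A.β * t) * (L / (A.p.factorial : ℝ)) * (A.β * ‖b - z‖) ^ (A.p - 1) := by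
        rw [hpow, mul_pow]
        ring
      _ ≤ _ := by gcongr
  rw [div_le_iff₀ hη]
  have hpos : 0 < A.α / 2 * A.β ^ A.p := by positivity
  calc 1 = (A.α / 2 * A.β ^ A.p) / (A.α / 2 * A.β ^ A.p) := (div_self hpos.ne').symm
    _ ≤ η * (L / (A.p.factorial : ℝ)) * y ^ (A.p - 1) / (A.α / 2 * A.β ^ A.p) := by gcongr
    _ = _ := by
      field_simp

end SaddleProblem

/-! ### Growth of the products `∏ (1 + x_j)` -/

/-- The product `(1 + x 0) ⋯ (1 + x (k - 1))`. -/
def growth (x : ℕ → ℝ) (k : ℕ) : ℝ := ∏ j ∈ Finset.range k, (1 + x j)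

@[simp]
lemma growth_zero (x : ℕ → ℝ) : growth x 0 = 1 := by simp [growth]

lemma growth_succ (x : ℕ → ℝ) (k : ℕ) : growth x (k + 1) = growth x k * (1 + x k) :=
  Finset.prod_range_succ _ _

lemma one_le_growth {x : ℕ → ℝ} {k : ℕ} (hx : ∀ j < k, 0 < x j) : 1 ≤ growth x k := by
  induction k with
  | zero => simp
  | succ k ih =>
    rw [growth_succ]
    have h1 := ih fun j hj => hx j (by omega)
    have h2 := hx k (by omega)
    nlinarith

/-- A bound on the number of steps by the logarithm of the growth. Steps with `x_k ≥ 1` double the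
product; for the others, `1` is split by the weighted inequality of arithmetic and geometric means
into a multiple of `c_k x_k ^ (-r)`, whose sum is at most `K`, and a multiple of `x_k / c_k`, whose
sum telescopes. -/
lemma count_le_add_logb_growth {x : ℕ → ℝ} {N : ℕ} {r K : ℝ} (hr₀ : 0 < r) (hr₁ : r ≤ 1)
    (hK : 0 < K) (hx : ∀ j < N, 0 < x j)
    (hsum : ∑ k ∈ Finset.range N, growth x k * x k ^ (-r) ≤ K) :
    (N : ℝ) ≤ K ^ (1 / (1 + r)) / (1 - (2 : ℝ) ^ (-(1 / (1 + r)))) + Real.logb 2 (growth x N) := by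
  set s := 1 / (1 + r) with hs
  have hs0 : 0 < s := by positivity
  have hs1 : s < 1 := by
    rw [hs, div_lt_one (by positivity)]
    linarith
  have hrs : 1 - s = r * s := by
    rw [hs]
    field_simp
    ring
  have hKs : 0 < K ^ s := by positivity
  have hA : 0 < K ^ (1 - s) := by positivity
  have hstep : ∀ k ∈ Finset.range N, (1 : ℝ) ≤
      (Real.logb 2 (growth x (k + 1)) - Real.logb 2 (growth x k)) +
      s / K ^ (1 - s) * (growth x k * x k ^ (-r)) +
      2 * (1 - s) * K ^ s * ((growth x k)⁻¹ - (growth x (k + 1))⁻¹) := by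
    intro k hk
    have hkN := Finset.mem_range.1 hk
    have hxk := hx k hkN
    have hc : 1 ≤ growth x k := one_le_growth fun j hj => hx j (by omega)
    have hc0 : 0 < growth x k := by linarith
    have hinv : (growth x k)⁻¹ - (growth x (k + 1))⁻¹ = x k / (1 + x k) * (growth x k)⁻¹ := by
      rw [growth_succ]
      field_simp
      ring
    have hlog : Real.logb 2 (growth x (k + 1)) - Real.logb 2 (growth x k) =
        Real.logb 2 (1 + x k) := by
      rw [growth_succ, Real.logb_mul hc0.ne' (by positivity)]
      ring
    rw [hinv, hlog]
    have h1s : 0 < 1 - s := by linarith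
    have hlog0 : 0 ≤ Real.logb 2 (1 + x k) := Real.logb_nonneg (by norm_num) (by linarith)
    rcases le_or_gt 1 (x k) with hle | hlt
    · have h1 : (1 : ℝ) ≤ Real.logb 2 (1 + x k) := by
        rw [Real.le_logb_iff_rpow_le (by norm_num) (by positivity)]
        norm_num
        linarith
      have h2 : 0 ≤ s / K ^ (1 - s) * (growth x k * x k ^ (-r)) := by positivity
      have h3 : 0 ≤ 2 * (1 - s) * K ^ s * (x k / (1 + x k) * (growth x k)⁻¹) := by positivity
      linarith
    · set P := growth x k * x k ^ (-r) / K ^ (1 - s) with hP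
      have hP0 : 0 < P := by positivity
      have hagm := Real.geom_mean_le_arith_mean2_weighted hs0.le h1s.le hP0.le
        (Real.rpow_nonneg hP0.le (-1 / r)) (by ring)
      have hone : P ^ s * (P ^ (-1 / r)) ^ (1 - s) = 1 := by
        rw [← Real.rpow_mul hP0.le, ← Real.rpow_add hP0, hrs]
        have : s + -1 / r * (r * s) = 0 := by
          field_simp
          ring
        rw [this, Real.rpow_zero]
      rw [hone] at hagm
      have hPr : P ^ (-1 / r) ≤ K ^ s * (x k * (growth x k)⁻¹) := by
        have e1 : P ^ (-1 / r) = growth x k ^ (-1 / r) * x k * K ^ s := by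
          rw [hP, Real.div_rpow (by positivity) hA.le, Real.mul_rpow hc0.le (by positivity),
            ← Real.rpow_mul hxk.le, ← Real.rpow_mul hK.le, div_eq_mul_inv, ← Real.rpow_neg hK.le,
            hrs]
          have h1 : -r * (-1 / r) = 1 := by field_simp
          have h2 : -(r * s * (-1 / r)) = s := by field_simp
          rw [h1, h2, Real.rpow_one]
        have e2 : growth x k ^ (-1 / r) ≤ (growth x k)⁻¹ := by
          rw [← Real.rpow_neg_one]
          refine Real.rpow_le_rpow_of_exponent_le hc ?_
          rw [div_le_iff₀ hr₀]
          linarith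
        rw [e1]
        calc _ ≤ (growth x k)⁻¹ * x k * K ^ s := by gcongr
          _ = _ := by ring
      have hhalf : x k * (growth x k)⁻¹ ≤ 2 * (x k / (1 + x k) * (growth x k)⁻¹) := by
        have : x k ≤ 2 * (x k / (1 + x k)) := by
          rw [mul_div_assoc', le_div_iff₀ (by positivity)]
          nlinarith
        calc _ ≤ 2 * (x k / (1 + x k)) * (growth x k)⁻¹ := by gcongr
          _ = _ := by ring
      have h4 : (1 - s) * P ^ (-1 / r) ≤
          2 * (1 - s) * K ^ s * (x k / (1 + x k) * (growth x k)⁻¹) := by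
        calc _ ≤ (1 - s) * (K ^ s * (2 * (x k / (1 + x k) * (growth x k)⁻¹))) := by
              gcongr
              exact hPr.trans (by gcongr)
          _ = _ := by ring
      have h5 : s * P = s / K ^ (1 - s) * (growth x k * x k ^ (-r)) := by
        rw [hP]
        ring
      linarith
  have htot := Finset.sum_le_sum hstep
  rw [Finset.sum_add_distrib, Finset.sum_add_distrib, ← Finset.mul_sum, ← Finset.mul_sum,
    Finset.sum_range_sub (fun k => Real.logb 2 (growth x k)),
    Finset.sum_range_sub' (fun k => (growth x k)⁻¹), Finset.sum_const, Finset.card_range,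
    nsmul_eq_mul, mul_one, growth_zero, Real.logb_one, inv_one, sub_zero] at htot
  have h1 : s / K ^ (1 - s) * ∑ k ∈ Finset.range N, growth x k * x k ^ (-r) ≤ s * K ^ s := by
    calc _ ≤ s / K ^ (1 - s) * K := by gcongr
      _ = s * (K / K ^ (1 - s)) := by ring
      _ = _ := by
        congr 1
        nth_rewrite 1 [← Real.rpow_one K]
        rw [← Real.rpow_sub hK]
        congr 1
        ring
  have hcN : 0 < (growth x N)⁻¹ := inv_pos.2 (by linarith [one_le_growth hx])
  have h2 : 2 * (1 - s) * K ^ s * (1 - (growth x N)⁻¹) ≤ 2 * (1 - s) * K ^ s := by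
    have : 0 ≤ 2 * (1 - s) * K ^ s := by
      have : 0 < 1 - s := by linarith
      positivity
    nlinarith
  -- `2 - s ≤ 2 ≤ 1 / (1 - 2 ^ (-s))`, because `2 ^ (-s) ≥ 1 / 2`
  have h3 : 2 * K ^ s ≤ K ^ s / (1 - (2 : ℝ) ^ (-s)) := by
    have e1 : (2 : ℝ) ^ (-1 : ℝ) ≤ (2 : ℝ) ^ (-s) :=
      Real.rpow_le_rpow_of_exponent_le (by norm_num) (by linarith)
    have e2 : (2 : ℝ) ^ (-s) < 1 := Real.rpow_lt_one_of_one_lt_of_neg (by norm_num) (by linarith)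
    rw [Real.rpow_neg_one] at e1
    rw [le_div_iff₀ (by linarith)]
    nlinarith
  nlinarith

/-- Once `c_k ≥ 2 K`, the ratio `c_k / K` grows at a superlinear rate. -/
lemma superlinear_growth {x : ℕ → ℝ} {N m : ℕ} {r K : ℝ} (hr₀ : 0 < r)
    (hK : 0 < K) (hx : ∀ j < N, 0 < x j) (hle : ∀ k < N, growth x k * x k ^ (-r) ≤ K)
    (hm : 2 * K ≤ growth x m) (j : ℕ) (hj : m + j ≤ N) :
    (2 : ℝ) ^ ((1 + 1 / r) ^ j) ≤ growth x (m + j) / K := by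
  induction j with
  | zero =>
    rw [pow_zero, Real.rpow_one, le_div_iff₀ hK]
    exact hm
  | succ j ih =>
    have ih' := ih (by omega)
    set g := growth x (m + j) with hg
    have hxk := hx (m + j) (by omega)
    have hg0 : 0 < g := by linarith [one_le_growth (x := x) (k := m + j) fun i hi => hx i (by omega)]
    have hgK : 0 < g / K := by positivity
    have hxlow : (g / K) ^ (1 / r) ≤ x (m + j) := by
      have h1 := hle (m + j) (by omega)
      rw [Real.rpow_neg hxk.le, ← div_eq_mul_inv, div_le_iff₀ (by positivity)] at h1
      have h2 : g / K ≤ x (m + j) ^ r := by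
        rw [div_le_iff₀ hK]
        linarith
      calc (g / K) ^ (1 / r) ≤ (x (m + j) ^ r) ^ (1 / r) :=
            Real.rpow_le_rpow hgK.le h2 (by positivity)
        _ = x (m + j) := by rw [one_div, Real.rpow_rpow_inv hxk.le hr₀.ne']
    calc (2 : ℝ) ^ ((1 + 1 / r) ^ (j + 1)) = ((2 : ℝ) ^ ((1 + 1 / r) ^ j)) ^ (1 + 1 / r) := by
          rw [← Real.rpow_mul (by norm_num), pow_succ]
      _ ≤ (g / K) ^ (1 + 1 / r) := Real.rpow_le_rpow (by positivity) ih' (by positivity)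
      _ = g / K * (g / K) ^ (1 / r) := by rw [Real.rpow_add hgK, Real.rpow_one]
      _ ≤ g / K * (1 + x (m + j)) := by
        gcongr
        linarith
      _ = _ := by
        rw [← add_assoc, growth_succ]
        ring

/-- The number of steps until the growth exceeds `K Y`: a first phase until it exceeds `2 K`, and a
superlinear second phase. -/
lemma count_le_superlinear {x : ℕ → ℝ} {N : ℕ} {r K Y : ℝ} (hr₀ : 0 < r) (hr₁ : r ≤ 1)
    (hK : 0 < K) (hx : ∀ j < N, 0 < x j)
    (hsum : ∑ k ∈ Finset.range N, growth x k * x k ^ (-r) ≤ K) (hY : 2 ≤ Y)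
    (hN : growth x N ≤ K * Y) :
    (N : ℝ) ≤ max (K ^ (1 / (1 + r)) / (1 - (2 : ℝ) ^ (-(1 / (1 + r)))) + Real.logb 2 K + 2) 1 +
      Real.logb (1 + 1 / r) (Real.logb 2 Y) := by
  have hterm : ∀ k < N, 0 ≤ growth x k * x k ^ (-r) := by
    intro k hk
    have h1 := hx k hk
    have h2 := one_le_growth (x := x) (k := k) fun i hi => hx i (by omega)
    positivity
  have hle : ∀ k < N, growth x k * x k ^ (-r) ≤ K := fun k hk =>
    (Finset.single_le_sum (fun i hi => hterm i (Finset.mem_range.1 hi))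
      (Finset.mem_range.2 hk)).trans hsum
  have hq : 1 < 1 + 1 / r := by
    have : 0 < 1 / r := by positivity
    linarith
  have hlogY : 1 ≤ Real.logb 2 Y := by
    rw [Real.le_logb_iff_rpow_le (by norm_num) (by linarith), Real.rpow_one]
    exact hY
  have hloglog : 0 ≤ Real.logb (1 + 1 / r) (Real.logb 2 Y) := Real.logb_nonneg hq hlogY
  -- the first phase
  have hfirst : ∀ m ≤ N, growth x m < 2 * K →
      (m : ℝ) ≤ K ^ (1 / (1 + r)) / (1 - (2 : ℝ) ^ (-(1 / (1 + r)))) + Real.logb 2 K + 1 := by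
    intro m hm hlt
    have hxm : ∀ j < m, 0 < x j := fun j hj => hx j (by omega)
    have h1 := count_le_add_logb_growth hr₀ hr₁ hK hxm ((Finset.sum_le_sum_of_subset_of_nonneg
      (Finset.range_subset_range.2 hm) fun i hi _ => hterm i (Finset.mem_range.1 hi)).trans hsum)
    have h2 : Real.logb 2 (growth x m) ≤ Real.logb 2 (2 * K) :=
      Real.logb_le_logb_of_le (by norm_num) (by linarith [one_le_growth hxm]) hlt.le
    rw [Real.logb_mul (by norm_num) hK.ne', Real.logb_self_eq_one (by norm_num)] at h2
    linarith
  -- the second phase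
  have hsecond : ∀ m j, m + j = N → 2 * K ≤ growth x m →
      (j : ℝ) ≤ Real.logb (1 + 1 / r) (Real.logb 2 Y) := by
    intro m j hj hm
    have h1 := superlinear_growth hr₀ hK hx hle hm j hj.le
    have h2 : (2 : ℝ) ^ ((1 + 1 / r) ^ j) ≤ Y := by
      refine h1.trans ?_
      rw [hj, div_le_iff₀ hK]
      linarith
    rw [← Real.le_logb_iff_rpow_le (by norm_num) (by linarith)] at h2
    rw [Real.le_logb_iff_rpow_le hq (by linarith), Real.rpow_natCast]
    exact h2
  by_cases hex : ∃ m, m ≤ N ∧ 2 * K ≤ growth x m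
  · classical
    obtain ⟨hmN, hmK⟩ := Nat.find_spec hex
    set m := Nat.find hex with hm
    have hj := hsecond m (N - m) (by omega) hmK
    rw [Nat.cast_sub hmN] at hj
    rcases Nat.eq_zero_or_pos m with h0 | hpos
    · rw [h0, Nat.cast_zero] at hj
      linarith [le_max_right
        (K ^ (1 / (1 + r)) / (1 - (2 : ℝ) ^ (-(1 / (1 + r)))) + Real.logb 2 K + 2) 1]
    · have hlt : growth x (m - 1) < 2 * K := by
        by_contra hge
        exact Nat.find_min hex (m := m - 1) (by omega) ⟨by omega, not_lt.1 hge⟩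
      have h1 := hfirst (m - 1) (by omega) hlt
      rw [Nat.cast_sub hpos, Nat.cast_one] at h1
      linarith [le_max_left
        (K ^ (1 / (1 + r)) / (1 - (2 : ℝ) ^ (-(1 / (1 + r)))) + Real.logb 2 K + 2) 1]
  · have hlt : growth x N < 2 * K := by
      by_contra hge
      exact hex ⟨N, le_rfl, not_lt.1 hge⟩
    have h1 := hfirst N le_rfl hlt
    linarith [le_max_left
      (K ^ (1 / (1 + r)) / (1 - (2 : ℝ) ^ (-(1 / (1 + r)))) + Real.logb 2 K + 2) 1]

namespace SaddleProblem

variable {E F : Type*} [NormedAddCommGroup E] [NormedSpace ℝ E]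
  [NormedAddCommGroup F] [NormedSpace ℝ F] (Q : SaddleProblem E F)

/-! ### Convergence of the method -/

/-- The outcomes of the iterations before the method returns. -/
lemma IsRun.spec {A : Params} (hp : 3 ≤ A.p) {Lp LΦ : ℝ} (hμ : 0 ≤ A.μ)
    (hf : Q.StronglyConvexConcave A.μ) (hF : Q.OpSmooth A.p Lp) (hLp : 0 ≤ Lp)
    (hlam : Lp ≤ A.lam) (hΦ : Q.MirrorSmooth LΦ) (hLΦ : 0 < LΦ) (hα : 0 < A.α)
    (hβ₀ : 0 < A.β) (hβ₁ : A.β ≤ 1) (hσ₀ : 0 < A.σ₀) {z : ℕ → Sp E F} {η : ℕ → ℝ}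
    (hrun : Q.IsRun A z η) {N : ℕ} (hN : ∀ j ≤ N, ¬ Q.Returns A z j) :
    ∀ k < N, 0 < η k ∧ Q.StepTest A (z k) (η k) (z (k + 1)) ∧
      1 / η k ≤ effLip A.p Lp LΦ A.lam * (2 / ((A.p.factorial : ℝ) * A.α * A.β ^ A.p)) *
        (LΦ ^ ((3 : ℝ) / 2) * ‖z (k + 1) - z k‖ +
          (A.β + LΦ ^ ((1 : ℝ) / 2)) * ‖Q.correction A z η k‖) ^ (A.p - 1) := by
  have hstep : ∀ k < N, z k ∈ Q.Z → 0 < trial A η k → 0 < η k ∧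
      Q.StepTest A (z k) (η k) (z (k + 1)) ∧
      1 / η k ≤ effLip A.p Lp LΦ A.lam * (2 / ((A.p.factorial : ℝ) * A.α * A.β ^ A.p)) *
        (LΦ ^ ((3 : ℝ) / 2) * ‖z (k + 1) - z k‖ +
          (A.β + LΦ ^ ((1 : ℝ) / 2)) * ‖Q.correction A z η k‖) ^ (A.p - 1) := by
    intro k hk hz hσ
    have hnot : ∀ j ≤ k, ¬ Q.Returns A z j := fun j hj => hN j (by omega)
    obtain ⟨h1, h2, h3⟩ := LineSearchReturns.spec Q hp hμ hf hF hLp hlam hΦ hLΦ hα hβ₀ hβ₁ hσ hz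
      (hrun.stepsize k hnot) (fun _ => hrun.update k hnot)
    exact ⟨h1, h2, h3.resolve_left fun hres => hN (k + 1) hk ⟨by omega, hres⟩⟩
  intro k
  induction k with
  | zero => exact fun hk => hstep 0 hk hrun.init hσ₀
  | succ k ih =>
    intro hk
    obtain ⟨w, hw, -⟩ := hrun.update k fun j hj => hN j (by omega)
    exact hstep (k + 1) hk (Q.mem_Z_of_mem_H hw) (div_pos (ih (by omega)).1 hβ₀)

/-- One step of the optimistic method, for the potential `D(z*, z_k) - ⟨v_k, z_k - z*⟩`. -/
lemma IsSubsolution.potential_step {A : Params} (hμ : 0 < A.μ)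
    (hf : Q.StronglyConvexConcave A.μ) {zs z z' : Sp E F} (hzs : Q.IsSaddlePoint zs)
    {v : Sp E F →L[ℝ] ℝ} {η : ℝ} (hη : 0 < η) (h : Q.IsSubsolution A z v η z') :
    (1 + η * A.μ) * (Q.D zs z' -
      ((η / (1 + η * A.μ)) • (Q.op z' - Q.regTaylor A.p A.lam z' z)) (z' - zs)) ≤
      Q.D zs z - v (z - zs) - v (z' - z) - Q.D z' z := by
  obtain ⟨w, hw, e⟩ := h
  have h1 := mul_le_mul_of_nonneg_left (Q.mul_D_le_of_saddle hf hzs hw) hη.le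
  have h2 := Q.gradΦ_sub_apply z z' zs
  have e' := congrArg (fun g : Sp E F →L[ℝ] ℝ => g (z' - zs)) e
  have h3 : (1 + η * A.μ) * (η / (1 + η * A.μ)) = η := by
    have : 0 < 1 + η * A.μ := by positivity
    field_simp
  have h4 : v (z' - zs) = v (z - zs) + v (z' - z) := by
    rw [← map_add]
    congr 1
    abel
  simp only [sub_apply, add_apply, smul_apply, smul_eq_mul, zero_apply] at *
  rw [mul_sub, ← mul_assoc, h3]
  linarith

lemma norm_correction_succ_le {A : Params} (hμ : 0 < A.μ) {z : ℕ → Sp E F} {η : ℕ → ℝ} {k : ℕ}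
    (hη : 0 < η k) (htest : Q.StepTest A (z k) (η k) (z (k + 1))) :
    (1 + η k * A.μ) * ‖Q.correction A z η (k + 1)‖ ≤ A.α / 2 * ‖z (k + 1) - z k‖ := by
  have h1 : 0 < 1 + η k * A.μ := by positivity
  rw [correction, norm_smul, Real.norm_of_nonneg (by positivity)]
  refine le_trans (le_of_eq ?_) htest
  field_simp

/-- Decay of `D(z*, z_n)` and summability of the squared displacements, with weights that grow by
the factors `1 + η_k μ`. -/
lemma energy_le {A : Params} (hμ : 0 < A.μ) (hα₀ : 0 < A.α)
    (hf : Q.StronglyConvexConcave A.μ) {zs : Sp E F} (hzs : Q.IsSaddlePoint zs)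
    {z : ℕ → Sp E F} {η : ℕ → ℝ} {N : ℕ} (hz₀ : z 0 ∈ Q.Z) (hη : ∀ k < N, 0 < η k)
    (hsub : ∀ k < N, Q.IsSubsolution A (z k) (Q.correction A z η k) (η k) (z (k + 1)))
    (htest : ∀ k < N, Q.StepTest A (z k) (η k) (z (k + 1))) :
    growth (fun k => η k * A.μ) N * ((1 - A.α / 2) * Q.D zs (z N)) +
      (1 - A.α) / 2 * ∑ k ∈ Finset.range N,
        growth (fun k => η k * A.μ) k * ‖z (k + 1) - z k‖ ^ 2 ≤ Q.D zs (z 0) := by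
  set x : ℕ → ℝ := fun k => η k * A.μ with hx
  have hx0 : ∀ k < N, 0 < x k := fun k hk => mul_pos (hη k hk) hμ
  have hZ : ∀ k ≤ N, z k ∈ Q.Z := by
    intro k hk
    cases k with
    | zero => exact hz₀
    | succ k =>
      obtain ⟨w, hw, -⟩ := hsub k hk
      exact Q.mem_Z_of_mem_H hw
  set v := Q.correction A z η with hv
  have hind : ∀ n ≤ N, growth x n * (Q.D zs (z n) - v n (z n - zs)) +
      (1 - A.α) / 2 * ∑ k ∈ Finset.range n, growth x k * ‖z (k + 1) - z k‖ ^ 2 +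
      growth x n * (‖v n‖ ^ 2 / A.α) ≤ Q.D zs (z 0) := by
    intro n
    induction n with
    | zero => simp [hv, correction]
    | succ n ih =>
      intro hn
      have ih' := ih (by omega)
      have hc : 1 ≤ growth x n := one_le_growth fun j hj => hx0 j (by omega)
      have hc0 : 0 < growth x n := by linarith
      have hxn : 0 < x n := hx0 n hn
      have hpot := IsSubsolution.potential_step Q hμ hf hzs (hη n hn) (hsub n hn)
      have hcor := Q.norm_correction_succ_le hμ (hη n hn) (htest n hn)
      have hvs : (η n / (1 + η n * A.μ)) • (Q.op (z (n + 1)) -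
          Q.regTaylor A.p A.lam (z (n + 1)) (z n)) = v (n + 1) := rfl
      rw [hvs] at hpot
      change (1 + x n) * ‖v (n + 1)‖ ≤ _ at hcor
      change (1 + x n) * _ ≤ _ - v n (z n - zs) - v n (z (n + 1) - z n) - _ at hpot
      set δ := ‖z (n + 1) - z n‖ with hδ
      have hδ0 : 0 ≤ δ := norm_nonneg _
      have hD := Q.half_sq_le_D (hZ n (by omega)) (hZ (n + 1) hn)
      rw [← hδ] at hD
      -- Young's inequality for the correction term
      have hyoung : -(v n (z (n + 1) - z n)) ≤ ‖v n‖ ^ 2 / A.α + A.α / 4 * δ ^ 2 := by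
        have h1 := (neg_le_abs _).trans ((v n).le_opNorm (z (n + 1) - z n))
        have h2 : ‖v n‖ * δ ≤ ‖v n‖ ^ 2 / A.α + A.α / 4 * δ ^ 2 := by
          have h3 : ‖v n‖ ^ 2 / A.α + A.α / 4 * δ ^ 2 - ‖v n‖ * δ =
              (‖v n‖ - A.α / 2 * δ) ^ 2 / A.α := by
            field_simp
            ring
          have h4 : 0 ≤ (‖v n‖ - A.α / 2 * δ) ^ 2 / A.α := by positivity
          linarith
        exact h1.trans h2
      have hnext : (1 + x n) * (‖v (n + 1)‖ ^ 2 / A.α) ≤ A.α / 4 * δ ^ 2 := by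
        have h1 : ((1 + x n) * ‖v (n + 1)‖) ^ 2 ≤ (A.α / 2 * δ) ^ 2 :=
          pow_le_pow_left₀ (by positivity) hcor 2
        have h2 : (1 + x n) * ‖v (n + 1)‖ ^ 2 ≤ ((1 + x n) * ‖v (n + 1)‖) ^ 2 := by
          rw [mul_pow]
          gcongr
          nlinarith
        rw [mul_div_assoc', div_le_iff₀ hα₀]
        nlinarith
      have hall : (1 + x n) * (Q.D zs (z (n + 1)) - v (n + 1) (z (n + 1) - zs)) +
          (1 - A.α) / 2 * δ ^ 2 + (1 + x n) * (‖v (n + 1)‖ ^ 2 / A.α) ≤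
          Q.D zs (z n) - v n (z n - zs) + ‖v n‖ ^ 2 / A.α := by linarith
      have hmul := mul_le_mul_of_nonneg_left hall hc0.le
      rw [Finset.sum_range_succ, growth_succ]
      linarith
  have hN := hind N le_rfl
  have hc : 1 ≤ growth x N := one_le_growth hx0
  have hlow : (1 - A.α / 2) * Q.D zs (z N) ≤
      Q.D zs (z N) - v N (z N - zs) + ‖v N‖ ^ 2 / A.α := by
    have h1 := (le_abs_self _).trans ((v N).le_opNorm (z N - zs))
    have h2 := Q.half_sq_le_D (hZ N le_rfl) hzs.mem
    rw [norm_sub_rev] at h2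
    have h3 : ‖v N‖ ^ 2 / A.α + A.α / 4 * ‖z N - zs‖ ^ 2 - ‖v N‖ * ‖z N - zs‖ =
        (‖v N‖ - A.α / 2 * ‖z N - zs‖) ^ 2 / A.α := by
      field_simp
      ring
    have h4 : 0 ≤ (‖v N‖ - A.α / 2 * ‖z N - zs‖) ^ 2 / A.α := by positivity
    have h5 : A.α / 4 * ‖z N - zs‖ ^ 2 ≤ A.α / 2 * Q.D zs (z N) := by nlinarith
    linarith
  have h6 := mul_le_mul_of_nonneg_left hlow (by linarith : (0 : ℝ) ≤ growth x N)
  linarith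

/-- Minkowski's inequality for the displacements and the correction terms. -/
lemma sum_growth_mul_sq_le {A : Params} (hμ : 0 < A.μ) (hα₀ : 0 < A.α)
    {z : ℕ → Sp E F} {η : ℕ → ℝ} {N : ℕ} (hη : ∀ k < N, 0 < η k)
    (htest : ∀ k < N, Q.StepTest A (z k) (η k) (z (k + 1))) {a b : ℝ} (ha : 0 ≤ a) (hb : 0 ≤ b) :
    ∑ k ∈ Finset.range N, growth (fun k => η k * A.μ) k *
        (a * ‖z (k + 1) - z k‖ + b * ‖Q.correction A z η k‖) ^ 2 ≤
      (a + b * (A.α / 2)) ^ 2 * ∑ k ∈ Finset.range N,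
        growth (fun k => η k * A.μ) k * ‖z (k + 1) - z k‖ ^ 2 := by
  set x : ℕ → ℝ := fun k => η k * A.μ with hx
  set S := ∑ k ∈ Finset.range N, growth x k * ‖z (k + 1) - z k‖ ^ 2 with hS
  have hx0 : ∀ k < N, 0 < x k := fun k hk => mul_pos (hη k hk) hμ
  have hc : ∀ k < N, 0 < growth x k := fun k hk =>
    lt_of_lt_of_le one_pos (one_le_growth fun j hj => hx0 j (by omega))
  have hcor : ∑ k ∈ Finset.range N, growth x k * ‖Q.correction A z η k‖ ^ 2 ≤
      A.α ^ 2 / 4 * S := by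
    have hshift : ∀ n ≤ N, ∑ k ∈ Finset.range n, growth x k * ‖Q.correction A z η k‖ ^ 2 ≤
        A.α ^ 2 / 4 * ∑ k ∈ Finset.range n, growth x k * ‖z (k + 1) - z k‖ ^ 2 := by
      intro n hn
      cases n with
      | zero => simp
      | succ n =>
        rw [Finset.sum_range_succ', Finset.sum_range_succ, mul_add, Finset.mul_sum]
        refine add_le_add (Finset.sum_le_sum fun k hk => ?_) ?_
        · have hkn := Finset.mem_range.1 hk
          have h1 := Q.norm_correction_succ_le hμ (hη k (by omega)) (htest k (by omega))
          change (1 + x k) * _ ≤ _ at h1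
          have hxk := hx0 k (by omega)
          have hck := hc k (by omega)
          have h2 : (1 + x k) * ‖Q.correction A z η (k + 1)‖ ^ 2 ≤
              (A.α / 2 * ‖z (k + 1) - z k‖) ^ 2 := by
            refine le_trans ?_ (pow_le_pow_left₀ (by positivity) h1 2)
            rw [mul_pow]
            gcongr
            nlinarith
          have h3 := mul_le_mul_of_nonneg_left h2 hck.le
          rw [growth_succ]
          linarith
        · have hcn := hc n (by omega)
          have h0 : 0 ≤ A.α ^ 2 / 4 * (growth x n * ‖z (n + 1) - z n‖ ^ 2) := by positivity
          simpa [correction] using h0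
    exact hshift N le_rfl
  have hyoung : ∀ k ∈ Finset.range N,
      growth x k * (a * ‖z (k + 1) - z k‖ + b * ‖Q.correction A z η k‖) ^ 2 ≤
      (a ^ 2 + a * b * (A.α / 2)) * (growth x k * ‖z (k + 1) - z k‖ ^ 2) +
      (b ^ 2 + a * b * (2 / A.α)) * (growth x k * ‖Q.correction A z η k‖ ^ 2) := by
    intro k hk
    have hck := hc k (Finset.mem_range.1 hk)
    set d := ‖z (k + 1) - z k‖
    set w := ‖Q.correction A z η k‖
    have h1 : (a ^ 2 + a * b * (A.α / 2)) * (growth x k * d ^ 2) +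
        (b ^ 2 + a * b * (2 / A.α)) * (growth x k * w ^ 2) - growth x k * (a * d + b * w) ^ 2 =
        growth x k * (a * b * (2 / A.α) * (A.α / 2 * d - w) ^ 2) := by
      field_simp
      ring
    have h2 : 0 ≤ growth x k * (a * b * (2 / A.α) * (A.α / 2 * d - w) ^ 2) := by positivity
    linarith
  refine (Finset.sum_le_sum hyoung).trans ?_
  rw [Finset.sum_add_distrib, ← Finset.mul_sum, ← Finset.mul_sum, ← hS]
  have h1 : 0 ≤ b ^ 2 + a * b * (2 / A.α) := by positivity
  refine (add_le_add le_rfl (mul_le_mul_of_nonneg_left hcor h1)).trans_eq ?_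
  field_simp
  ring

end SaddleProblem

lemma gammaConst_eq {p : ℕ} {LΦ α β : ℝ} (hα₁ : α < 1) :
    gammaConst p LΦ α β = (2 / ((p.factorial : ℝ) * α * β ^ p)) ^ (1 / ((p : ℝ) - 1)) *
      √(2 / (1 - α)) * (LΦ ^ ((3 : ℝ) / 2) + (β + LΦ ^ ((1 : ℝ) / 2)) * (α / 2)) := by
  have h1 : 0 < 1 - α := by linarith
  have h2 : 1 / √(2 * (1 - α)) = √(2 / (1 - α)) / 2 := by
    have h3 : √(2 * (1 - α)) ≠ 0 := by positivity
    rw [div_eq_div_iff h3 two_ne_zero, ← Real.sqrt_mul (by positivity)]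
    have h4 : 2 / (1 - α) * (2 * (1 - α)) = 2 ^ 2 := by
      field_simp
    rw [h4, Real.sqrt_sq (by norm_num)]
    norm_num
  rw [gammaConst, h2]
  ring

lemma gammaConst_pos {p : ℕ} {LΦ α β : ℝ} (hLΦ : 0 < LΦ) (hα₀ : 0 < α) (hα₁ : α < 1)
    (hβ₀ : 0 < β) : 0 < gammaConst p LΦ α β := by
  have h1 : 0 < 1 - α := by linarith
  rw [gammaConst_eq hα₁]
  positivity

lemma effLip_pos {p : ℕ} (hp : 1 ≤ p) {Lp LΦ lam : ℝ} (hLp : 0 ≤ Lp) (hLΦ : 0 < LΦ)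
    (hlam : 0 < lam) : 0 < effLip p Lp LΦ lam := by
  rw [effLip]
  positivity

lemma kappaTilde_rpow {p : ℕ} (hp : 2 ≤ p) {μ Lp LΦ lam α β D₀ : ℝ} (hμ : 0 < μ)
    (hγ : 0 < gammaConst p LΦ α β) (hL : 0 < effLip p Lp LΦ lam) (hD₀ : 0 ≤ D₀) :
    kappaTilde p μ Lp LΦ lam α β D₀ ^ (2 / ((p : ℝ) - 1)) =
      gammaConst p LΦ α β ^ 2 * (effLip p Lp LΦ lam / μ) ^ (2 / ((p : ℝ) - 1)) * D₀ := by
  have hp' : (2 : ℝ) ≤ p := by exact_mod_cast hp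
  have hp1 : (p : ℝ) - 1 ≠ 0 := by linarith
  have e : kappaTilde p μ Lp LΦ lam α β D₀ = gammaConst p LΦ α β ^ (p - 1) *
      (effLip p Lp LΦ lam / μ) * D₀ ^ (((p : ℝ) - 1) / 2) := by
    rw [kappaTilde]
    ring
  rw [e, Real.mul_rpow (by positivity) (by positivity), Real.mul_rpow (by positivity)
    (by positivity), ← Real.rpow_natCast, ← Real.rpow_mul hγ.le, ← Real.rpow_mul hD₀,
    Nat.cast_sub (by omega : 1 ≤ p), Nat.cast_one, mul_div_cancel₀ _ hp1,
    div_mul_div_cancel₀ two_ne_zero, div_self hp1, Real.rpow_one]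
  norm_cast

namespace SaddleProblem

variable {E F : Type*} [NormedAddCommGroup E] [NormedSpace ℝ E]
  [NormedAddCommGroup F] [NormedSpace ℝ F] (Q : SaddleProblem E F)

/-- The stepsizes before the method returns: the growth of the weights bounds the distance to the
saddle point, and a weighted sum of negative powers of the stepsizes is bounded. -/
lemma IsRun.growth_bounds {A : Params} (hp : 3 ≤ A.p) {Lp LΦ : ℝ} (hμ : 0 < A.μ)
    (hf : Q.StronglyConvexConcave A.μ) (hF : Q.OpSmooth A.p Lp) (hLp : 0 ≤ Lp)
    (hlam₀ : 0 < A.lam) (hlam : Lp ≤ A.lam) (hΦ : Q.MirrorSmooth LΦ) (hLΦ : 0 < LΦ) (hα : 0 < A.α)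
    (hα₁ : A.α < 1) (hβ₀ : 0 < A.β) (hβ₁ : A.β ≤ 1) (hσ₀ : 0 < A.σ₀) {zs : Sp E F}
    (hzs : Q.IsSaddlePoint zs) {z : ℕ → Sp E F} {η : ℕ → ℝ}
    (hrun : Q.IsRun A z η) {N : ℕ} (hN : ∀ j ≤ N, ¬ Q.Returns A z j) :
    (∀ k < N, 0 < η k * A.μ) ∧
    growth (fun k => η k * A.μ) N * ((2 - A.α) * Q.D zs (z N)) ≤ 2 * Q.D zs (z 0) ∧
    ∑ k ∈ Finset.range N, growth (fun k => η k * A.μ) k *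
        (η k * A.μ) ^ (-(2 / ((A.p : ℝ) - 1))) ≤
      kappaTilde A.p A.μ Lp LΦ A.lam A.α A.β (Q.D zs (z 0)) ^ (2 / ((A.p : ℝ) - 1)) := by
  have hspec := IsRun.spec Q hp hμ.le hf hF hLp hlam hΦ hLΦ hα hβ₀ hβ₁ hσ₀ hrun hN
  have hη : ∀ k < N, 0 < η k := fun k hk => (hspec k hk).1
  have htest := fun k hk => (hspec k hk).2.1
  have hx0 : ∀ k < N, 0 < η k * A.μ := fun k hk => mul_pos (hη k hk) hμ
  have henergy := Q.energy_le hμ hα hf hzs hrun.init hη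
    (fun k hk => hrun.update k fun j hj => hN j (by omega)) htest
  have h1α : 0 < 1 - A.α := by linarith
  have hZN : z N ∈ Q.Z := by
    cases N with
    | zero => exact hrun.init
    | succ n =>
      obtain ⟨w, hw, -⟩ := hrun.update n fun j hj => hN j (by omega)
      exact Q.mem_Z_of_mem_H hw
  have hD0 := Q.D_nonneg hrun.init hzs.mem
  have hDN := Q.D_nonneg hZN hzs.mem
  set c := growth (fun k => η k * A.μ) with hc
  have hc1 : ∀ k ≤ N, 1 ≤ c k := fun k hk => one_le_growth fun j hj => hx0 j (by omega)
  set S := ∑ k ∈ Finset.range N, c k * ‖z (k + 1) - z k‖ ^ 2 with hS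
  have hS0 : 0 ≤ S := Finset.sum_nonneg fun k hk => by
    have := hc1 k (Finset.mem_range.1 hk).le
    positivity
  refine ⟨hx0, ?_, ?_⟩
  · have : 0 ≤ (1 - A.α) / 2 * S := by positivity
    linarith
  have hSle : S ≤ 2 / (1 - A.α) * Q.D zs (z 0) := by
    have hcN := hc1 N le_rfl
    have h1 : 0 ≤ c N * ((1 - A.α / 2) * Q.D zs (z N)) := by
      have : 0 < 1 - A.α / 2 := by linarith
      positivity
    rw [div_mul_eq_mul_div, le_div_iff₀ h1α]
    linarith
  have hp' : (3 : ℝ) ≤ A.p := by exact_mod_cast hp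
  have hp1 : (A.p : ℝ) - 1 ≠ 0 := by linarith
  set r := 2 / ((A.p : ℝ) - 1) with hr
  have hr0 : 0 < r := div_pos two_pos (by linarith)
  set L := effLip A.p Lp LΦ A.lam with hL
  have hL0 : 0 < L := effLip_pos (by omega) hLp hLΦ hlam₀
  set q := 2 / ((A.p.factorial : ℝ) * A.α * A.β ^ A.p) with hq
  have hq0 : 0 < q := by positivity
  set a := LΦ ^ ((3 : ℝ) / 2) with ha
  set b := A.β + LΦ ^ ((1 : ℝ) / 2) with hb
  have ha0 : 0 ≤ a := by positivity
  have hb0 : 0 ≤ b := by positivity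
  have hγ := gammaConst_pos (p := A.p) hLΦ hα hα₁ hβ₀
  have hterm : ∀ k ∈ Finset.range N, c k * (η k * A.μ) ^ (-r) ≤
      (L / A.μ) ^ r * q ^ r *
        (c k * (a * ‖z (k + 1) - z k‖ + b * ‖Q.correction A z η k‖) ^ 2) := by
    intro k hk
    have hkN := Finset.mem_range.1 hk
    obtain ⟨hηk, -, hbound⟩ := hspec k hkN
    set y := a * ‖z (k + 1) - z k‖ + b * ‖Q.correction A z η k‖ with hy
    have hy0 : 0 ≤ y := by positivity
    have hck := hc1 k hkN.le
    have hinv : (η k * A.μ)⁻¹ ≤ L / A.μ * q * y ^ (A.p - 1) := by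
      calc (η k * A.μ)⁻¹ = 1 / η k / A.μ := by field_simp
        _ ≤ L * q * y ^ (A.p - 1) / A.μ := by gcongr
        _ = _ := by ring
    have hypow : (y ^ (A.p - 1)) ^ r = y ^ 2 := by
      rw [← Real.rpow_natCast, ← Real.rpow_mul hy0, Nat.cast_sub (by omega : 1 ≤ A.p),
        Nat.cast_one, hr, mul_div_cancel₀ _ hp1]
      norm_cast
    calc c k * (η k * A.μ) ^ (-r) = c k * ((η k * A.μ)⁻¹) ^ r := by
          rw [Real.rpow_neg (hx0 k hkN).le, Real.inv_rpow (hx0 k hkN).le]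
      _ ≤ c k * (L / A.μ * q * y ^ (A.p - 1)) ^ r := by
        have := hx0 k hkN
        gcongr
      _ = _ := by
        rw [Real.mul_rpow (by positivity) (by positivity), Real.mul_rpow (by positivity) hq0.le,
          hypow]
        ring
  refine (Finset.sum_le_sum hterm).trans ?_
  rw [← Finset.mul_sum, kappaTilde_rpow (by omega) hμ hγ hL0 hD0]
  have hmink := Q.sum_growth_mul_sq_le hμ hα hη htest ha0 hb0
  calc _ ≤ (L / A.μ) ^ r * q ^ r *
        ((a + b * (A.α / 2)) ^ 2 * (2 / (1 - A.α) * Q.D zs (z 0))) := by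
        gcongr
        exact hmink.trans (by gcongr)
    _ = _ := by
      have hqr : q ^ r = (q ^ (1 / ((A.p : ℝ) - 1))) ^ 2 := by
        rw [← Real.rpow_natCast, ← Real.rpow_mul hq0.le, hr]
        congr 1
        push_cast
        ring
      have hsq : √(2 / (1 - A.α)) ^ 2 = 2 / (1 - A.α) := Real.sq_sqrt (by positivity)
      rw [gammaConst_eq hα₁, mul_pow, mul_pow, hsq, hqr]
      ring

/-- It suffices to bound, by `B - 1`, the number of iterations after which the method has neither
returned nor come close to the saddle point. -/
lemma FindsWithin.of_forall_le {A : Params} {zs : Sp E F} {z : ℕ → Sp E F} {B : ℝ} (hB : 0 ≤ B)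
    (h : ∀ N : ℕ, (∀ j ≤ N, ¬ Q.Returns A z j) → A.ε < Q.D zs (z N) → (N : ℝ) ≤ B - 1) :
    Q.FindsWithin A zs z B := by
  by_contra hnot
  have hret : ∀ N : ℕ, (N : ℝ) ≤ B → ¬ Q.Returns A z N ∧ A.ε < Q.D zs (z N) := by
    intro N
    induction N using Nat.strong_induction_on with
    | _ N ih =>
      intro hNB
      have hlt : ∀ j < N, ¬ Q.Returns A z j := fun j hj =>
        (ih j hj (le_trans (by exact_mod_cast hj.le) hNB)).1
      by_contra hcon
      refine hnot ⟨N, hNB, hlt, ?_⟩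
      by_contra hor
      rw [not_or, not_le] at hor
      exact hcon hor
  have hfl : (⌊B⌋₊ : ℝ) ≤ B := Nat.floor_le hB
  have h1 := h ⌊B⌋₊ (fun j hj => (hret j (le_trans (by exact_mod_cast hj) hfl)).1)
    (hret _ hfl).2
  linarith [Nat.lt_floor_add_one B]

end SaddleProblem

end SaddleOpt

theorem corollary7p6 {E F : Type*}
    [NormedAddCommGroup E] [NormedSpace ℝ E] [FiniteDimensional ℝ E]
    [NormedAddCommGroup F] [NormedSpace ℝ F] [FiniteDimensional ℝ F]
    (Q : SaddleOpt.SaddleProblem E F)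
    (p : ℕ) (μ Lp LΦ lam α β ε σ₀ : ℝ)
    (hp : 3 ≤ p) (hμ : 0 < μ) (hLp : 0 ≤ Lp) (hLΦ : 0 < LΦ)
    (hlam : 0 < lam) (hlamLp : Lp ≤ lam)
    (hα₀ : 0 < α) (hα₁ : α < 1) (hβ₀ : 0 < β) (hβ₁ : β < 1) (hε : 0 < ε) (hσ₀ : 0 < σ₀)
    (hf : Q.StronglyConvexConcave μ) (hF : Q.OpSmooth p Lp) (hΦ : Q.MirrorSmooth LΦ)
    (zs : SaddleOpt.Sp E F) (hzs : Q.IsSaddlePoint zs)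
    (z : ℕ → SaddleOpt.Sp E F) (η : ℕ → ℝ)
    (hrun : Q.IsRun ⟨p, μ, lam, α, β, ε, σ₀⟩ z η) :
    (1 / ((2 - α) * SaddleOpt.gammaConst p LΦ α β ^ 2) *
          (μ / SaddleOpt.effLip p Lp LΦ lam) ^ (2 / ((p : ℝ) - 1)) ≤ ε →
      Q.FindsWithin ⟨p, μ, lam, α, β, ε, σ₀⟩ zs z
        (max
          (1 / (1 - (2 : ℝ) ^ (-(((p : ℝ) - 1) / ((p : ℝ) + 1)))) *
              SaddleOpt.kappaTilde p μ Lp LΦ lam α β (Q.D zs (z 0)) ^ (2 / ((p : ℝ) + 1)) +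
            Real.logb 2 (2 * Q.D zs (z 0) / ((2 - α) * ε)) + 1)
          1)) ∧
    (ε < 1 / ((2 - α) * SaddleOpt.gammaConst p LΦ α β ^ 2) *
          (μ / SaddleOpt.effLip p Lp LΦ lam) ^ (2 / ((p : ℝ) - 1)) →
      Q.FindsWithin ⟨p, μ, lam, α, β, ε, σ₀⟩ zs z
        (max
            (SaddleOpt.kappaTilde p μ Lp LΦ lam α β (Q.D zs (z 0)) ^ (2 / ((p : ℝ) + 1)) /
                (1 - (2 : ℝ) ^ (-(((p : ℝ) - 1) / ((p : ℝ) + 1)))) +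
              2 * Real.logb 2 (SaddleOpt.kappaTilde p μ Lp LΦ lam α β (Q.D zs (z 0))) /
                ((p : ℝ) - 1) + 2)
            1 +
          Real.logb (((p : ℝ) + 1) / 2)
            (Real.logb 2
              (2 * μ ^ (2 / ((p : ℝ) - 1)) /
                ((2 - α) * SaddleOpt.gammaConst p LΦ α β ^ 2 *
                  SaddleOpt.effLip p Lp LΦ lam ^ (2 / ((p : ℝ) - 1)) * ε))) + 1)) := by
  have hp' : (3 : ℝ) ≤ p := by exact_mod_cast hp
  have hp1 : 0 < (p : ℝ) - 1 := by linarith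
  have hγ := SaddleOpt.gammaConst_pos (p := p) hLΦ hα₀ hα₁ hβ₀
  have hL := SaddleOpt.effLip_pos (p := p) (by omega) hLp hLΦ hlam
  have hD₀ := Q.D_nonneg hrun.init hzs.mem
  have h2α : 0 < 2 - α := by linarith
  set γ := SaddleOpt.gammaConst p LΦ α β with hγdef
  set L := SaddleOpt.effLip p Lp LΦ lam with hLdef
  set D₀ := Q.D zs (z 0) with hD₀def
  set κ := SaddleOpt.kappaTilde p μ Lp LΦ lam α β D₀ with hκdef
  set r := 2 / ((p : ℝ) - 1) with hr
  have hr₀ : 0 < r := by positivity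
  have hr₁ : r ≤ 1 := by
    rw [hr, div_le_one hp1]
    linarith
  have hKeq : κ ^ r = γ ^ 2 * (L / μ) ^ r * D₀ :=
    SaddleOpt.kappaTilde_rpow (by omega) hμ hγ hL hD₀
  have hκ₀ : 0 ≤ κ := by
    rw [hκdef, SaddleOpt.kappaTilde]
    positivity
  -- the exponents of the statement in terms of `r = 2 / (p - 1)`
  have hs : ((p : ℝ) - 1) / ((p : ℝ) + 1) = 1 / (1 + r) := by
    rw [hr]
    field_simp
    ring
  have hκs : κ ^ (2 / ((p : ℝ) + 1)) = (κ ^ r) ^ (1 / (1 + r)) := by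
    rw [← Real.rpow_mul hκ₀]
    congr 1
    rw [← hs, hr]
    field_simp
  have hq : ((p : ℝ) + 1) / 2 = 1 + 1 / r := by
    rw [hr]
    field_simp
    ring
  have hlogK : 2 * Real.logb 2 κ / ((p : ℝ) - 1) = Real.logb 2 (κ ^ r) := by
    rcases hκ₀.eq_or_lt with h0 | h0
    · rw [← h0, Real.zero_rpow hr₀.ne', Real.logb_zero]
      simp
    · rw [Real.logb_rpow_eq_mul_logb_of_pos h0, hr]
      ring
  have hbounds := fun (N : ℕ) hN => SaddleOpt.SaddleProblem.IsRun.growth_bounds Q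
    (A := ⟨p, μ, lam, α, β, ε, σ₀⟩) hp hμ hf hF hLp hlam hlamLp hΦ hLΦ hα₀ hα₁ hβ₀ hβ₁.le hσ₀ hzs
    hrun (N := N) hN
  -- if `D(z*, z_N) > ε`, then the growth of the weights is bounded, and `D(z*, z_0) > 0`
  have hcount : ∀ N : ℕ,
      (∀ j ≤ N, ¬ Q.Returns ⟨p, μ, lam, α, β, ε, σ₀⟩ z j) → ε < Q.D zs (z N) →
      0 < D₀ ∧ 0 < κ ^ r ∧ 1 ≤ SaddleOpt.growth (fun k => η k * μ) N ∧
        SaddleOpt.growth (fun k => η k * μ) N ≤ 2 * D₀ / ((2 - α) * ε) := by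
    intro N hN hDN
    obtain ⟨h1, h2, -⟩ := hbounds N hN
    have h3 := SaddleOpt.one_le_growth h1
    have h4 : SaddleOpt.growth (fun k => η k * μ) N * ((2 - α) * ε) ≤ 2 * D₀ :=
      le_trans (by gcongr) h2
    have h5 : 0 < SaddleOpt.growth (fun k => η k * μ) N * ((2 - α) * ε) := by positivity
    have h6 : 0 < D₀ := by linarith
    refine ⟨h6, ?_, h3, ?_⟩
    · rw [hKeq]
      positivity
    · rw [le_div_iff₀ (by positivity)]
      exact h4
  rw [hs, hκs, hlogK, hq]
  constructor
  · intro _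
    refine SaddleOpt.SaddleProblem.FindsWithin.of_forall_le Q
      (zero_le_one.trans (le_max_right _ _)) fun N hN hDN => ?_
    obtain ⟨hD, hK, hc1, hc⟩ := hcount N hN hDN
    obtain ⟨hx, -, hsum⟩ := hbounds N hN
    have h1 := SaddleOpt.count_le_add_logb_growth hr₀ hr₁ hK hx hsum
    have h2 := Real.logb_le_logb_of_le (b := 2) one_lt_two (by linarith) hc
    have h3 := le_max_left (1 / (1 - (2 : ℝ) ^ (-(1 / (1 + r)))) * (κ ^ r) ^ (1 / (1 + r)) +
      Real.logb 2 (2 * D₀ / ((2 - α) * ε)) + 1) 1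
    rw [one_div_mul_eq_div] at h3 ⊢
    linarith
  · intro hsmall
    set Y := 2 * μ ^ r / ((2 - α) * γ ^ 2 * L ^ r * ε) with hY
    have hY2 : 2 ≤ Y := by
      rw [hY, le_div_iff₀ (by positivity)]
      rw [Real.div_rpow hμ.le hL.le, div_mul_div_comm, one_mul, lt_div_iff₀ (by positivity)]
        at hsmall
      linarith
    have hlog : 0 ≤ Real.logb (1 + 1 / r) (Real.logb 2 Y) := by
      refine Real.logb_nonneg ?_ ?_
      · have : 0 < 1 / r := by positivity
        linarith
      · rw [Real.le_logb_iff_rpow_le one_lt_two (by linarith), Real.rpow_one]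
        exact hY2
    refine SaddleOpt.SaddleProblem.FindsWithin.of_forall_le Q ?_ fun N hN hDN => ?_
    · have := le_max_right ((κ ^ r) ^ (1 / (1 + r)) / (1 - (2 : ℝ) ^ (-(1 / (1 + r)))) +
        Real.logb 2 (κ ^ r) + 2) 1
      linarith
    obtain ⟨hD, hK, hc1, hc⟩ := hcount N hN hDN
    obtain ⟨hx, -, hsum⟩ := hbounds N hN
    have hKY : κ ^ r * Y = 2 * D₀ / ((2 - α) * ε) := by
      rw [hKeq, hY, Real.div_rpow hL.le hμ.le]
      have h1 : L ^ r ≠ 0 := by positivity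
      have h2 : μ ^ r ≠ 0 := by positivity
      field_simp
    have h1 := SaddleOpt.count_le_superlinear hr₀ hr₁ hK hx hsum hY2 (hKY ▸ hc)
    linarith
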